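/- Let $x\mapsto s(t)A(t)x+d(t)$, $t\in I$, be a one-parameter equiform motion of Euclidean space $\mathbf E^7$ of class $C^1$, where $I\subset\mathbb R$ is an open interval containing $0$, $s(t)>0$, $A(t)\in SO(7)$, $d(t)\in\mathbb R^7$, with $s(0)=1$, $A(0)=\mathrm{Id}$, $d(0)=0$. Put $s'=\dot s(0)$, $\Omega=\dot A(0)$ (a skew-symmetric matrix, $\Omega=(\Omega_{ij})_{1\le i,j\le 7}$), $b'=\dot d(0)$. Let $x(\theta,\phi)=(\cos\theta\cos\phi,\sin\theta\cos\phi,\sin\phi,0,0,0,0)^T$ parametrize the unit sphere of the coordinate $3$-space $[x_1x_2x_3]$, and let $$X(t,\theta,\phi)=\bigl[\mathrm{Id}+t(s'\,\mathrm{Id}+\Omega)\bigr]x(\theta,\phi)+t\,b'$$ be the kinematic $3$-surface generated by the sphere, that is, the representation of its motion up to first order at $t=0$. Assume: (i) the surface is foliated by spheres: for every $t$ the first three columns of $\mathrm{Id}+t(s'\mathrm{Id}+\Omega)$ are pairwise orthogonal and of equal length, i.e. $$\sum_{k=3}^7\Omega_{1k}\Omega_{2k}=0,\quad \Omega_{12}\Omega_{23}-\sum_{k=4}^7\Omega_{1k}\Omega_{3k}=0,\quad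 \Omega_{12}\Omega_{13}+\sum_{k=4}^7\Omega_{2k}\Omega_{3k}=0,$$ $$\sum_{k=3}^7\Omega_{1k}^2=\sum_{k=3}^7\Omega_{2k}^2,\qquad \Omega_{12}^2+\sum_{k=4}^7\Omega_{1k}^2=\Omega_{23}^2+\sum_{k=4}^7\Omega_{3k}^2;$$ (ii) there is no translation in the $3$-space of the starting sphere: $b'_1=b'_2=b'_3=0$. Let $g_{ij}=\partial_iX\cdot\partial_jX$ be the first fundamental form in the coordinates $(x_1,x_2,x_3)=(t,\theta,\phi)$, let $\Gamma_{ij}^l=\frac12 g^{lm}\bigl[\partial_j g_{im}+\partial_i g_{jm}-\partial_m g_{ij}\bigr]$, and let $$\mathbf K=g^{ij}\bigl[\partial_l\Gamma_{ij}^l-\partial_j\Gamma_{il}^l+\Gamma_{ij}^l\Gamma_{lm}^m-\Gamma_{il}^m\Gamma_{jm}^l\bigr]$$ be the scalar curvature (summation over repeated indices). Then there is no nonempty open set $W$ of parameters $(\theta,\phi)\in\mathbb R^2$ such that $X$ is regular at $(0,\theta,\phi)$ for all $(\theta,\phi)\in W$ (the vectors $X_t,X_\theta,X_\phi$ are linearly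 independent there) and $\mathbf K(0,\theta,\phi)=-6$ for all $(\theta,\phi)\in W$. The same holds if the scalar curvature is taken with the opposite sign convention: $-\mathbf K(0,\theta,\phi)=-6$ on such a set $W$ is impossible too. In particular, no kinematic $3$-surface in $\mathbf E^7$ foliated by spheres has constant scalar curvature $-6$. -/

import Mathlib

open scoped Matrix

namespace Kinematic

/-- A one-parameter equiform motion `x ↦ s(t) A(t) x + d(t)` of Euclidean `7`-space, of class `C¹`
on an open interval `I` containing `0`, the moving and the fixed frame coinciding at `t = 0`.
Points of `𝐄⁷` are written in Cartesian coordinates `0, …, 6`; the Euclidean inner product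
is `⬝ᵥ`. -/
structure EquiformMotion where
  I : Set ℝ
  isOpen_I : IsOpen I
  ordConnected_I : I.OrdConnected
  zero_mem_I : (0 : ℝ) ∈ I
  /-- the scaling factor -/
  s : ℝ → ℝ
  /-- the rotational part -/
  A : ℝ → Matrix (Fin 7) (Fin 7) ℝ
  /-- the position of the origin of the moving space -/
  d : ℝ → Fin 7 → ℝ
  s_contDiffOn : ContDiffOn ℝ 1 s I
  A_contDiffOn : ∀ i j, ContDiffOn ℝ 1 (fun t => A t i j) I
  d_contDiffOn : ∀ i, ContDiffOn ℝ 1 (fun t => d t i) I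
  s_pos : ∀ t ∈ I, 0 < s t
  A_mem : ∀ t ∈ I, A t ∈ Matrix.specialOrthogonalGroup (Fin 7) ℝ
  s_zero : s 0 = 1
  A_zero : A 0 = 1
  d_zero : d 0 = 0

/-- The unit sphere of the coordinate `3`-space spanned by the first three axes. -/
noncomputable def sphere (θ φ : ℝ) : Fin 7 → ℝ :=
  ![Real.cos θ * Real.cos φ, Real.sin θ * Real.cos φ, Real.sin φ, 0, 0, 0, 0]

namespace EquiformMotion

variable (M : EquiformMotion)

/-- `s'`, the derivative of the scaling factor at `t = 0`. -/
noncomputable def sPrime : ℝ := deriv M.s 0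

/-- `Ω`, the derivative of the rotational part at `t = 0` (a skew-symmetric matrix). -/
noncomputable def Omega : Matrix (Fin 7) (Fin 7) ℝ :=
  Matrix.of fun i j => deriv (fun t => M.A t i j) 0

/-- `b'`, the derivative of the translational part at `t = 0`. -/
noncomputable def bPrime : Fin 7 → ℝ := fun i => deriv (fun t => M.d t i) 0

/-- The kinematic `3`-surface: the representation, up to first order at `t = 0`, of the motion of
the sphere, `X(t, θ, φ) = (I + t (s' I + Ω)) x(θ, φ) + t b'`.
The coordinates are `u 0 = t`, `u 1 = θ`, `u 2 = φ`. -/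
noncomputable def surface (u : Fin 3 → ℝ) : Fin 7 → ℝ :=
  (1 + u 0 • (M.sPrime • (1 : Matrix (Fin 7) (Fin 7) ℝ) + M.Omega)) *ᵥ sphere (u 1) (u 2)
    + u 0 • M.bPrime

/-- The conditions on `Ω` under which, for every `t`, the first three columns of
`I + t (s' I + Ω)` are pairwise orthogonal and of equal length, so that the surface is foliated by
round spheres. The entries `Ω 0 1, …, Ω 0 6` are `ω₁, …, ω₆`, the entries `Ω 1 2, …, Ω 1 6` are
`ω₇, …, ω₁₁` and `Ω 2 3, …, Ω 2 6` are `ω₁₂, …, ω₁₅`. -/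
def FoliatedBySpheres : Prop :=
  ∑ k ∈ Finset.Ici (2 : Fin 7), M.Omega 0 k * M.Omega 1 k = 0 ∧
  M.Omega 0 1 * M.Omega 1 2 - ∑ k ∈ Finset.Ici (3 : Fin 7), M.Omega 0 k * M.Omega 2 k = 0 ∧
  M.Omega 0 1 * M.Omega 0 2 + ∑ k ∈ Finset.Ici (3 : Fin 7), M.Omega 1 k * M.Omega 2 k = 0 ∧
  ∑ k ∈ Finset.Ici (2 : Fin 7), M.Omega 0 k ^ 2
    = ∑ k ∈ Finset.Ici (2 : Fin 7), M.Omega 1 k ^ 2 ∧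
  M.Omega 0 1 ^ 2 + ∑ k ∈ Finset.Ici (3 : Fin 7), M.Omega 0 k ^ 2
    = M.Omega 1 2 ^ 2 + ∑ k ∈ Finset.Ici (3 : Fin 7), M.Omega 2 k ^ 2

/-- There is no translation in the `3`-space which contains the starting sphere:
`b'₁ = b'₂ = b'₃ = 0`. -/
def NoTranslation : Prop := M.bPrime 0 = 0 ∧ M.bPrime 1 = 0 ∧ M.bPrime 2 = 0

end EquiformMotion

/-- The partial derivative with respect to the `i`-th coordinate. -/
noncomputable def pd {E : Type*} [NormedAddCommGroup E] [NormedSpace ℝ E] (i : Fin 3)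
    (f : (Fin 3 → ℝ) → E) (u : Fin 3 → ℝ) : E :=
  fderiv ℝ f u (Pi.single i 1)

/-- The first fundamental form `g_ij` of a parametrized `3`-surface in `𝐄⁷`. -/
noncomputable def firstForm (X : (Fin 3 → ℝ) → Fin 7 → ℝ) (u : Fin 3 → ℝ) :
    Matrix (Fin 3) (Fin 3) ℝ :=
  Matrix.of fun i j => pd i X u ⬝ᵥ pd j X u

/-- The Christoffel symbols of the second kind `Γ^l_ij`. -/
noncomputable def christoffel (X : (Fin 3 → ℝ) → Fin 7 → ℝ) (l i j : Fin 3) (u : Fin 3 → ℝ) : ℝ :=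
  (1 / 2) * ∑ m, (firstForm X u)⁻¹ l m *
    (pd j (fun v => firstForm X v i m) u + pd i (fun v => firstForm X v j m) u
      - pd m (fun v => firstForm X v i j) u)

/-- The scalar curvature of the metric `g_ij` (positive for round spheres). -/
noncomputable def scalarCurvature (X : (Fin 3 → ℝ) → Fin 7 → ℝ) (u : Fin 3 → ℝ) : ℝ :=
  ∑ i, ∑ j, (firstForm X u)⁻¹ i j *
    ((∑ l, pd l (christoffel X l i j) u) - (∑ l, pd j (christoffel X l i l) u)
      + (∑ l, ∑ m, christoffel X l i j u * christoffel X m l m u)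
      - (∑ l, ∑ m, christoffel X m i l u * christoffel X l j m u))

/-- The parametrized surface `X` is regular (an immersion) at `u`: the three coordinate tangent
vectors are linearly independent. -/
def RegularAt (X : (Fin 3 → ℝ) → Fin 7 → ℝ) (u : Fin 3 → ℝ) : Prop :=
  LinearIndependent ℝ fun i => pd i X u

end Kinematic

/-! Let n be the point of the unit sphere, w the axial vector of the upper left 3 × 3 block of Ω, q
the projection of -Ωb' to the 3-space of the sphere, k the common squared length of the first three
columns of Ω, and β = |b'|². The sphere condition makes Ω conformal on that 3-space, so the metric
depends only on s', k, β, w and q (`firstForm_surface`).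

At t = 0 the Gram factor is D = s'² + k + β + 2y - (|w|² - x²), and D²K is a polynomial in x = w·n,
y = q·n, z = q·(w × n) (`scalarCurvature_of_firstForm_eq`). Regularity gives D ≠ 0. Thus K = c on an
open set says that a polynomial vanishes there. By analyticity, and because the angles cover the
sphere, it vanishes for every unit n (`numerator_eq_zero_of_isOpen`).

The reflection n ↦ -n separates odd and even parts. If w ≠ 0, the odd part forces q = 0 as soon as c
≠ 4 (`drift_eq_zero_of_axis_ne_zero`). What remains is even: its x⁴ coefficient forces c = 6, and
then its x² coefficient, which should vanish, is positive because |w|² ≤ k (`sq_axis_le`). If w = 0,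
the even part forces q = 0, and the remaining scalar relation forces D = 0, against regularity. The
two sign conventions are the cases c = -6 and c = 6. -/

namespace Kinematic

/-! ### Scalar curvature as an algebraic function of the 2-jet of the metric -/

/-- Twice the Christoffel symbols of the first kind, from the first derivatives `d` of a metric. -/
def christoffelLower (d : Fin 3 → Matrix (Fin 3) (Fin 3) ℝ) (i j m : Fin 3) : ℝ :=
  d j i m + d i j m - d m i j

/-- The Christoffel symbols of the second kind, from the inverse metric `H` and the first
derivatives `d` of the metric. -/
noncomputable def christoffelValue (H : Matrix (Fin 3) (Fin 3) ℝ)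
    (d : Fin 3 → Matrix (Fin 3) (Fin 3) ℝ) (l i j : Fin 3) : ℝ :=
  (1 / 2) * ∑ m, H l m * christoffelLower d i j m

/-- The derivatives of the inverse metric. -/
def inverseDeriv (H : Matrix (Fin 3) (Fin 3) ℝ) (d : Fin 3 → Matrix (Fin 3) (Fin 3) ℝ)
    (p : Fin 3) : Matrix (Fin 3) (Fin 3) ℝ :=
  -(H * d p * H)

/-- The derivatives of the Christoffel symbols, from the inverse metric and the derivatives
`d`, `dd` of the metric of first and second order. -/
noncomputable def christoffelDeriv (H : Matrix (Fin 3) (Fin 3) ℝ)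
    (d : Fin 3 → Matrix (Fin 3) (Fin 3) ℝ) (dd : Fin 3 → Fin 3 → Matrix (Fin 3) (Fin 3) ℝ)
    (p l i j : Fin 3) : ℝ :=
  (1 / 2) * ∑ m, (inverseDeriv H d p l m * christoffelLower d i j m +
    H l m * christoffelLower (dd p) i j m)

/-- The scalar curvature, from the inverse metric and the derivatives of the metric. -/
noncomputable def curvatureValue (H : Matrix (Fin 3) (Fin 3) ℝ)
    (d : Fin 3 → Matrix (Fin 3) (Fin 3) ℝ) (dd : Fin 3 → Fin 3 → Matrix (Fin 3) (Fin 3) ℝ) : ℝ :=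
  ∑ i, ∑ j, H i j *
    ((∑ l, christoffelDeriv H d dd l l i j) - (∑ l, christoffelDeriv H d dd j l i l)
      + (∑ l, ∑ m, christoffelValue H d l i j * christoffelValue H d m l m)
      - (∑ l, ∑ m, christoffelValue H d m i l * christoffelValue H d l j m))

/-- The symmetric `3 × 3` matrix with upper triangular entries `a, b, c, d, e, f`. -/
def symMatrix (a b c d e f : ℝ) : Matrix (Fin 3) (Fin 3) ℝ :=
  Matrix.of ![![a, b, c], ![b, d, e], ![c, e, f]]

section symMatrix

variable (a b c d e f : ℝ)

@[simp] theorem symMatrix_zero_zero : symMatrix a b c d e f 0 0 = a := rfl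
@[simp] theorem symMatrix_zero_one : symMatrix a b c d e f 0 1 = b := rfl
@[simp] theorem symMatrix_zero_two : symMatrix a b c d e f 0 2 = c := rfl
@[simp] theorem symMatrix_one_zero : symMatrix a b c d e f 1 0 = b := rfl
@[simp] theorem symMatrix_one_one : symMatrix a b c d e f 1 1 = d := rfl
@[simp] theorem symMatrix_one_two : symMatrix a b c d e f 1 2 = e := rfl
@[simp] theorem symMatrix_two_zero : symMatrix a b c d e f 2 0 = c := rfl
@[simp] theorem symMatrix_two_one : symMatrix a b c d e f 2 1 = e := rfl
@[simp] theorem symMatrix_two_two : symMatrix a b c d e f 2 2 = f := rfl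

end symMatrix

/-- Factoring out H leaves Christoffel symbols in place of products of inverse metrics, so their
closed forms can be substituted before anything is expanded. -/
theorem christoffelDeriv_eq (H : Matrix (Fin 3) (Fin 3) ℝ)
    (d : Fin 3 → Matrix (Fin 3) (Fin 3) ℝ) (dd : Fin 3 → Fin 3 → Matrix (Fin 3) (Fin 3) ℝ)
    (p l i j : Fin 3) :
    christoffelDeriv H d dd p l i j = ∑ a, H l a * ((1 / 2) * christoffelLower (dd p) i j a -
      ∑ b, d p a b * christoffelValue H d b i j) := by
  simp only [christoffelDeriv, christoffelValue, inverseDeriv, Fin.sum_univ_three,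
    Matrix.neg_apply, Matrix.mul_apply]
  ring

/-- The entries of the Ricci tensor, from the inverse metric and the derivatives of the metric. -/
noncomputable def ricciValue (H : Matrix (Fin 3) (Fin 3) ℝ)
    (d : Fin 3 → Matrix (Fin 3) (Fin 3) ℝ) (dd : Fin 3 → Fin 3 → Matrix (Fin 3) (Fin 3) ℝ)
    (i j : Fin 3) : ℝ :=
  (∑ l, christoffelDeriv H d dd l l i j) - (∑ l, christoffelDeriv H d dd j l i l)
      + (∑ l, ∑ m, christoffelValue H d l i j * christoffelValue H d m l m)
      - (∑ l, ∑ m, christoffelValue H d m i l * christoffelValue H d l j m)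

/-! ### Curvature of the model jet; U, V, Z are the normal, east and north components of q and w -/

section Jet

variable (T s k Uq Vq Zq Uw Vw Zw e : ℝ)

/-- The inverse metric of the kinematic surface at `t = 0` in the rescaled frame in which `∂_θ` is
divided by `cos φ`; `e` is the reciprocal of the Gram factor. -/
def modelInverse : Matrix (Fin 3) (Fin 3) ℝ :=
  symMatrix e (-Zw * e) (Vw * e) (1 + Zw ^ 2 * e) (-Zw * Vw * e) (1 + Vw ^ 2 * e)

/-- The first derivatives of the metric at `t = 0` in the rescaled frame, with `T = tan φ`. -/
def modelDeriv : Fin 3 → Matrix (Fin 3) (Fin 3) ℝ :=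
  ![symMatrix 0 Vq Zq (2 * s) 0 (2 * s),
    symMatrix (2 * Vq) (-T * Vw) (Uw - T * Zw) 0 0 0,
    symMatrix (2 * Zq) (-T * Zw - Uw) 0 (-2 * T) 0 0]

/-- The second derivatives of the metric at `t = 0` in the rescaled frame. -/
def modelDerivTwo : Fin 3 → Fin 3 → Matrix (Fin 3) (Fin 3) ℝ :=
  ![![symMatrix 0 0 0 (2 * s ^ 2 + 2 * k) 0 (2 * s ^ 2 + 2 * k),
      symMatrix 0 (-Uq + T * Zq) (-T * Vq) 0 0 0,
      symMatrix 0 (-T * Vq) (-Uq) (-4 * s * T) 0 0],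
    ![symMatrix 0 (-Uq + T * Zq) (-T * Vq) 0 0 0,
      symMatrix (2 * (-Uq + T * Zq)) (-T * (-Uw + T * Zw)) (Vw + T ^ 2 * Vw) 0 0 0,
      symMatrix (-2 * T * Vq) (T ^ 2 * Vw - Vw) 0 0 0 0],
    ![symMatrix 0 (-T * Vq) (-Uq) (-4 * s * T) 0 0,
      symMatrix (-2 * T * Vq) (T ^ 2 * Vw - Vw) 0 0 0 0,
      symMatrix (-2 * Uq) (2 * T * Uw - 2 * Zw) 0 (-2 * (1 - T ^ 2)) 0 0]]

/-- The Christoffel symbols at `t = 0` in the rescaled frame. -/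
def modelChristoffel : Fin 3 → Matrix (Fin 3) (Fin 3) ℝ :=
  ![symMatrix 0 (e * (Vq - Zw * s + Vw * Uw)) (e * (Zq + Zw * Uw + Vw * s)) (-e * s) 0 (-e * s),
    symMatrix 0 (s - Zw * (e * (Vq - Zw * s + Vw * Uw)))
      (-Uw - Zw * (e * (Zq + Zw * Uw + Vw * s))) (Zw * e * s) (-T) (Zw * e * s),
    symMatrix 0 (Uw + Vw * (e * (Vq - Zw * s + Vw * Uw)))
      (s + Vw * (e * (Zq + Zw * Uw + Vw * s))) (T - Vw * e * s) 0 (-Vw * e * s)]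

theorem christoffelValue_model (l i j : Fin 3) :
    christoffelValue (modelInverse Vw Zw e) (modelDeriv T s Vq Zq Uw Vw Zw) l i j =
      modelChristoffel T s Vq Zq Uw Vw Zw e l i j := by
  fin_cases l <;> fin_cases i <;> fin_cases j <;>
    simp [christoffelValue, christoffelLower, Fin.sum_univ_three, modelInverse, modelDeriv,
      modelChristoffel] <;> ring

/-- The Ricci tensor at `t = 0` in the rescaled frame. -/
def modelRicci : Matrix (Fin 3) (Fin 3) ℝ :=
  symMatrix (2 * Uw ^ 2 - 2 * k + 2 * Uw ^ 2 * Zw ^ 2 * e + 2 * Uw ^ 2 * Vw ^ 2 * e + 2 * Zq * Uw * Zw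
      * e + Zq ^ 2 * e + 2 * Vq * Uw * Vw * e + Vq ^ 2 * e - k * Zw ^ 2 * e - k * Vw ^ 2 * e + 2
      * s * Zq * Vw * e - 2 * s * Vq * Zw * e + s ^ 2 * Zw ^ 2 * e + s ^ 2 * Vw ^ 2 * e + Zq ^ 2
      * Vw ^ 2 * e ^ 2 - 2 * Vq * Zq * Vw * Zw * e ^ 2 + Vq ^ 2 * Zw ^ 2 * e ^ 2 + 2 * s * Zq *
      Vw * Zw ^ 2 * e ^ 2 + 2 * s * Zq * Vw ^ 3 * e ^ 2 - 2 * s * Vq * Zw ^ 3 * e ^ 2 - 2 * s *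
      Vq * Vw ^ 2 * Zw * e ^ 2 + s ^ 2 * Zw ^ 4 * e ^ 2 + 2 * s ^ 2 * Vw ^ 2 * Zw ^ 2 * e ^ 2 +
      s ^ 2 * Vw ^ 4 * e ^ 2) (Zw + Uw ^ 2 * Zw * e - k * Zw * e + s * Uw * Vw * e + s * Vq * e - s ^ 2 * Zw * e - Zq *
      Uw * Vw ^ 2 * e ^ 2 + Vq * Uw * Vw * Zw * e ^ 2 - Vq * Zq * Vw * e ^ 2 + Vq ^ 2 * Zw * e ^
      2 + 2 * s * Zq * Vw * Zw * e ^ 2 - 2 * s * Vq * Zw ^ 2 * e ^ 2 + s ^ 2 * Zw ^ 3 * e ^ 2 +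
      s ^ 2 * Vw ^ 2 * Zw * e ^ 2) (-Vw - Uw ^ 2 * Vw * e + k * Vw * e + s * Uw * Zw * e + s * Zq * e + s ^ 2 * Vw * e - Zq *
      Uw * Vw * Zw * e ^ 2 - Zq ^ 2 * Vw * e ^ 2 + Vq * Uw * Zw ^ 2 * e ^ 2 + Vq * Zq * Zw * e ^
      2 - 2 * s * Zq * Vw ^ 2 * e ^ 2 + 2 * s * Vq * Vw * Zw * e ^ 2 - s ^ 2 * Vw * Zw ^ 2 * e ^
      2 - s ^ 2 * Vw ^ 3 * e ^ 2) (1 - Vw ^ 2 * e + Uw ^ 2 * e - k * e - s ^ 2 * e + Uw ^ 2 * Vw ^ 2 * e ^ 2 + 2 * Vq * Uw *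
      Vw * e ^ 2 + Vq ^ 2 * e ^ 2 + 2 * s * Zq * Vw * e ^ 2 - 2 * s * Vq * Zw * e ^ 2 + s ^ 2 *
      Zw ^ 2 * e ^ 2 + s ^ 2 * Vw ^ 2 * e ^ 2) (-Vw * Zw * e + Uw ^ 2 * Vw * Zw * e ^ 2 + Zq * Uw * Vw * e ^ 2 + Vq * Uw * Zw * e ^ 2 + Vq
      * Zq * e ^ 2) (1 - Zw ^ 2 * e + Uw ^ 2 * e - k * e - s ^ 2 * e + Uw ^ 2 * Zw ^ 2 * e ^ 2 + 2 * Zq * Uw *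
      Zw * e ^ 2 + Zq ^ 2 * e ^ 2 + 2 * s * Zq * Vw * e ^ 2 - 2 * s * Vq * Zw * e ^ 2 + s ^ 2 *
      Zw ^ 2 * e ^ 2 + s ^ 2 * Vw ^ 2 * e ^ 2)

/-- The second derivatives cancel except through k, and T = tan φ and `Uq` disappear. Passing
through the Ricci tensor keeps each polynomial identity small. -/
theorem ricciValue_model (i j : Fin 3) :
    ricciValue (modelInverse Vw Zw e) (modelDeriv T s Vq Zq Uw Vw Zw)
      (modelDerivTwo T s k Uq Vq Zq Uw Vw Zw) i j = modelRicci s k Vq Zq Uw Vw Zw e i j := by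
  simp only [ricciValue, christoffelDeriv_eq, christoffelValue_model]
  fin_cases i <;> fin_cases j <;>
    simp only [Fin.zero_eta, Fin.mk_one, Fin.reduceFinMk, christoffelLower, Fin.sum_univ_three,
      modelInverse, modelDeriv, modelDerivTwo, Matrix.cons_val,
      modelChristoffel, modelRicci, symMatrix_zero_zero, symMatrix_zero_one, symMatrix_zero_two,
      symMatrix_one_zero, symMatrix_one_one, symMatrix_one_two, symMatrix_two_zero,
      symMatrix_two_one, symMatrix_two_two] <;> ring

/-- Besides s, k and e, only `Uw` and the rotation invariants of the tangential vectors (V, Z)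
survive: their inner products and their determinant. This is what makes the curvature a polynomial
in x, y, z over a power of the Gram factor. -/
theorem curvatureValue_model :
    curvatureValue (modelInverse Vw Zw e) (modelDeriv T s Vq Zq Uw Vw Zw)
      (modelDerivTwo T s k Uq Vq Zq Uw Vw Zw) =
    2 - e * (2 * s ^ 2 + 4 * k + 2 * (Vw ^ 2 + Zw ^ 2) - 4 * Uw ^ 2)
      + e ^ 2 * (4 * s * (s * (Vw ^ 2 + Zw ^ 2) - 2 * (Zw * Vq - Vw * Zq))
        + 2 * (Vq ^ 2 + Zq ^ 2) + 4 * Uw * (Vw * Vq + Zw * Zq)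
        + 2 * Uw ^ 2 * (Vw ^ 2 + Zw ^ 2)) := by
  have h : ∀ H d dd, curvatureValue H d dd = ∑ i, ∑ j, H i j * ricciValue H d dd i j :=
    fun _ _ _ => rfl
  rw [h]
  simp only [ricciValue_model, Fin.sum_univ_three]
  simp only [modelInverse, modelRicci, symMatrix_zero_zero,
    symMatrix_zero_one, symMatrix_zero_two, symMatrix_one_zero, symMatrix_one_one,
    symMatrix_one_two, symMatrix_two_zero, symMatrix_two_one, symMatrix_two_two]
  ring

end Jet

/-! ### Rescaling of coordinates -/

/-- Invariance of the scalar curvature under a diagonal change of coordinates. -/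
theorem curvatureValue_scale (c : Fin 3 → ℝ) (hc : ∀ i, c i ≠ 0) (H : Matrix (Fin 3) (Fin 3) ℝ)
    (d : Fin 3 → Matrix (Fin 3) (Fin 3) ℝ) (dd : Fin 3 → Fin 3 → Matrix (Fin 3) (Fin 3) ℝ) :
    curvatureValue (Matrix.of fun i j => H i j / (c i * c j))
      (fun p => Matrix.of fun i j => c p * c i * c j * d p i j)
      (fun p q => Matrix.of fun i j => c p * c q * c i * c j * dd p q i j) =
    curvatureValue H d dd := by
  -- The factors `c` are constants, so the change of coordinates is linear and the jets scale like
  -- tensors, without inhomogeneous terms. It is applied with cos φ frozen at the point.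
  have h1 : ∀ i j m, christoffelLower
      (fun p => Matrix.of fun i j => c p * c i * c j * d p i j) i j m =
      c i * c j * c m * christoffelLower d i j m := by
    intro i j m; simp only [christoffelLower, Matrix.of_apply]; ring
  have h2 : ∀ p i j m, christoffelLower
      (fun q => Matrix.of fun i j => c p * c q * c i * c j * dd p q i j) i j m =
      c p * c i * c j * c m * christoffelLower (dd p) i j m := by
    intro p i j m; simp only [christoffelLower, Matrix.of_apply]; ring
  have h3 : ∀ l i j, christoffelValue (Matrix.of fun i j => H i j / (c i * c j))
      (fun p => Matrix.of fun i j => c p * c i * c j * d p i j) l i j =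
      c i * c j / c l * christoffelValue H d l i j := by
    intro l i j
    simp only [christoffelValue, h1, Matrix.of_apply, Finset.mul_sum]
    refine Finset.sum_congr rfl fun m _ => ?_
    have := hc l; have := hc m
    field_simp
  have h4 : ∀ p l i j, christoffelDeriv (Matrix.of fun i j => H i j / (c i * c j))
      (fun p => Matrix.of fun i j => c p * c i * c j * d p i j)
      (fun p q => Matrix.of fun i j => c p * c q * c i * c j * dd p q i j) p l i j =
      c p * c i * c j / c l * christoffelDeriv H d dd p l i j := by
    intro p l i j
    simp only [christoffelDeriv_eq, h2, h3, Matrix.of_apply, Finset.mul_sum]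
    refine Finset.sum_congr rfl fun m _ => ?_
    have := hc l; have := hc m
    have h5 : ∑ b, c p * c m * c b * d p m b * (c i * c j / c b * christoffelValue H d b i j) =
        c p * c m * c i * c j * ∑ b, d p m b * christoffelValue H d b i j := by
      rw [Finset.mul_sum]
      refine Finset.sum_congr rfl fun b _ => ?_
      have := hc b
      field_simp
    rw [h5]
    field_simp
  simp only [curvatureValue, h3, h4, Matrix.of_apply]
  refine Finset.sum_congr rfl fun i _ => Finset.sum_congr rfl fun j _ => ?_
  have hi := hc i; have hj := hc j
  have e1 : ∑ l, c l * c i * c j / c l * christoffelDeriv H d dd l l i j =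
      c i * c j * ∑ l, christoffelDeriv H d dd l l i j := by
    rw [Finset.mul_sum]
    refine Finset.sum_congr rfl fun l _ => ?_
    have := hc l
    field_simp
  have e2 : ∑ l, c j * c i * c l / c l * christoffelDeriv H d dd j l i l =
      c i * c j * ∑ l, christoffelDeriv H d dd j l i l := by
    rw [Finset.mul_sum]
    refine Finset.sum_congr rfl fun l _ => ?_
    have := hc l
    field_simp
  have e3 : ∑ l, ∑ m, c i * c j / c l * christoffelValue H d l i j *
      (c l * c m / c m * christoffelValue H d m l m) =
      c i * c j * ∑ l, ∑ m, christoffelValue H d l i j * christoffelValue H d m l m := by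
    simp only [Finset.mul_sum]
    refine Finset.sum_congr rfl fun l _ => Finset.sum_congr rfl fun m _ => ?_
    have := hc l; have := hc m
    field_simp
  have e4 : ∑ l, ∑ m, c i * c l / c m * christoffelValue H d m i l *
      (c j * c m / c l * christoffelValue H d l j m) =
      c i * c j * ∑ l, ∑ m, christoffelValue H d m i l * christoffelValue H d l j m := by
    simp only [Finset.mul_sum]
    refine Finset.sum_congr rfl fun l _ => Finset.sum_congr rfl fun m _ => ?_
    have := hc l; have := hc m
    field_simp
  rw [e1, e2, e3, e4]
  field_simp

/-! ### Partial derivatives and the passage from a surface to its metric jet -/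

theorem pd_eq_of_hasDerivAt {E : Type*} [NormedAddCommGroup E] [NormedSpace ℝ E]
    {f : (Fin 3 → ℝ) → E} {v : Fin 3 → ℝ} {p : Fin 3} {f' : E}
    (hf : DifferentiableAt ℝ f v)
    (h : HasDerivAt (fun x => f (Function.update v p x)) f' (v p)) : pd p f v = f' := by
  have h1 : HasDerivAt (fun x => f (Function.update v p x)) (pd p f v) (v p) := by
    have h2 : HasDerivAt (Function.update v p) (Pi.single p (1 : ℝ)) (v p) :=
      hasDerivAt_update v p (v p)
    have h3 : HasFDerivAt f (fderiv ℝ f v) (Function.update v p (v p)) := by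
      rw [Function.update_eq_self]; exact hf.hasFDerivAt
    exact h3.comp_hasDerivAt (v p) h2
  exact h1.unique h

theorem pd_mul {f g : (Fin 3 → ℝ) → ℝ} {v : Fin 3 → ℝ} (p : Fin 3)
    (hf : DifferentiableAt ℝ f v) (hg : DifferentiableAt ℝ g v) :
    pd p (fun w => f w * g w) v = pd p f v * g v + f v * pd p g v := by
  rw [pd, fderiv_fun_mul hf hg]
  simp [pd]
  ring

theorem pd_const_mul {f : (Fin 3 → ℝ) → ℝ} {v : Fin 3 → ℝ} (p : Fin 3) (c : ℝ)
    (hf : DifferentiableAt ℝ f v) : pd p (fun w => c * f w) v = c * pd p f v := by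
  rw [pd, fderiv_const_mul hf]
  simp [pd]

theorem pd_add {f g : (Fin 3 → ℝ) → ℝ} {v : Fin 3 → ℝ} (p : Fin 3)
    (hf : DifferentiableAt ℝ f v) (hg : DifferentiableAt ℝ g v) :
    pd p (fun w => f w + g w) v = pd p f v + pd p g v := by
  rw [pd, fderiv_fun_add hf hg]
  simp [pd]

theorem pd_sub {f g : (Fin 3 → ℝ) → ℝ} {v : Fin 3 → ℝ} (p : Fin 3)
    (hf : DifferentiableAt ℝ f v) (hg : DifferentiableAt ℝ g v) :
    pd p (fun w => f w - g w) v = pd p f v - pd p g v := by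
  rw [pd, fderiv_fun_sub hf hg]
  simp [pd]

theorem pd_sum {ι : Type*} (s : Finset ι) {f : ι → (Fin 3 → ℝ) → ℝ} {v : Fin 3 → ℝ} (p : Fin 3)
    (hf : ∀ i ∈ s, DifferentiableAt ℝ (f i) v) :
    pd p (fun w => ∑ i ∈ s, f i w) v = ∑ i ∈ s, pd p (f i) v := by
  rw [pd, fderiv_fun_sum hf]
  simp [pd]

theorem differentiableAt_inv_apply {g : (Fin 3 → ℝ) → Matrix (Fin 3) (Fin 3) ℝ} {u : Fin 3 → ℝ}
    (hg : ∀ i j, DifferentiableAt ℝ (fun v => g v i j) u) (hu : (g u).det ≠ 0) (i j : Fin 3) :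
    DifferentiableAt ℝ (fun v => (g v)⁻¹ i j) u := by
  have hdet : DifferentiableAt ℝ (fun v => (g v).det) u := by
    simp only [Matrix.det_fin_three]
    have h := hg
    fun_prop
  have hadj : DifferentiableAt ℝ (fun v => (g v).adjugate i j) u := by
    have h := hg
    simp only [Matrix.adjugate_fin_three]
    fin_cases i <;> fin_cases j <;> simp <;> fun_prop
  simp only [Matrix.inv_def, Ring.inverse_eq_inv', Matrix.smul_apply, smul_eq_mul]
  exact (hdet.inv hu).mul hadj

/-- Differentiate g g⁻¹ = 1, which holds near u because the determinant is continuous and nonzero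
there, and solve for the derivative of g⁻¹. -/
theorem pd_inv_apply {g : (Fin 3 → ℝ) → Matrix (Fin 3) (Fin 3) ℝ} {u : Fin 3 → ℝ}
    (hg : ∀ i j, DifferentiableAt ℝ (fun v => g v i j) u) (hu : (g u).det ≠ 0)
    {d : Fin 3 → Matrix (Fin 3) (Fin 3) ℝ} (hd : ∀ p i j, pd p (fun v => g v i j) u = d p i j)
    (p i j : Fin 3) :
    pd p (fun v => (g v)⁻¹ i j) u = inverseDeriv (g u)⁻¹ d p i j := by
  have hinv := differentiableAt_inv_apply hg hu
  have hdet : ContinuousAt (fun v => (g v).det) u := by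
    have : DifferentiableAt ℝ (fun v => (g v).det) u := by
      simp only [Matrix.det_fin_three]
      have h := hg
      fun_prop
    exact this.continuousAt
  have hne := hdet.eventually_ne hu
  set E : Matrix (Fin 3) (Fin 3) ℝ := Matrix.of fun i j => pd p (fun v => (g v)⁻¹ i j) u with hE
  have key : d p * (g u)⁻¹ + g u * E = 0 := by
    ext a b
    have h1 : (fun v => ∑ c, g v a c * (g v)⁻¹ c b) =ᶠ[nhds u]
        fun _ => (1 : Matrix (Fin 3) (Fin 3) ℝ) a b := by
      filter_upwards [hne] with v hv
      rw [← Matrix.mul_apply, Matrix.mul_nonsing_inv _ (isUnit_iff_ne_zero.2 hv)]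
    have h2 : pd p (fun v => ∑ c, g v a c * (g v)⁻¹ c b) u = 0 := by
      rw [pd, h1.fderiv_eq]; simp
    rw [pd_sum _ _ fun c _ => (hg a c).fun_mul (hinv c b)] at h2
    simp only [pd_mul p (hg a _) (hinv _ b), hd, Finset.sum_add_distrib] at h2
    simpa [Matrix.mul_apply, hE] using h2
  have h3 : E = inverseDeriv (g u)⁻¹ d p := by
    have h4 := congrArg ((g u)⁻¹ * ·) key
    simp only [mul_add, mul_zero, Matrix.nonsing_inv_mul_cancel_left _ _
      (isUnit_iff_ne_zero.2 hu)] at h4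
    rw [inverseDeriv, mul_assoc]
    exact eq_neg_of_add_eq_zero_right h4
  exact congrFun (congrFun h3 i) j

/-- The metric and its first derivatives must be known as functions, since they are differentiated
again; second derivatives and invertibility are needed only at u. -/
theorem scalarCurvature_eq_curvatureValue {X : (Fin 3 → ℝ) → Fin 7 → ℝ} {u : Fin 3 → ℝ}
    {g : (Fin 3 → ℝ) → Matrix (Fin 3) (Fin 3) ℝ}
    {d : (Fin 3 → ℝ) → Fin 3 → Matrix (Fin 3) (Fin 3) ℝ}
    {dd : Fin 3 → Fin 3 → Matrix (Fin 3) (Fin 3) ℝ}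
    (hX : ∀ v, firstForm X v = g v)
    (hg : ∀ i j, Differentiable ℝ fun v => g v i j)
    (hd : ∀ v p i j, pd p (fun w => g w i j) v = d v p i j)
    (hdiff : ∀ q i j, Differentiable ℝ fun v => d v q i j)
    (hdd : ∀ p q i j, pd p (fun v => d v q i j) u = dd p q i j)
    (hu : (g u).det ≠ 0) :
    scalarCurvature X u = curvatureValue (g u)⁻¹ (d u) dd := by
  have h1 : ∀ l i j v, christoffel X l i j v = christoffelValue (g v)⁻¹ (d v) l i j := by
    intro l i j v
    simp only [christoffel, christoffelValue, christoffelLower, hX, hd]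
  have hinv := differentiableAt_inv_apply (fun i j => hg i j u) hu
  have h2 : ∀ p l i j, pd p (christoffel X l i j) u =
      christoffelDeriv (g u)⁻¹ (d u) dd p l i j := by
    intro p l i j
    have hl : ∀ m, DifferentiableAt ℝ (fun v => christoffelLower (d v) i j m) u := fun m =>
      (((hdiff j i m).add (hdiff i j m)).sub (hdiff m i j)).differentiableAt
    have hpl : ∀ m, pd p (fun v => christoffelLower (d v) i j m) u =
        christoffelLower (dd p) i j m := by
      intro m
      simp only [christoffelLower]
      rw [pd_sub p ((hdiff j i m u).fun_add (hdiff i j m u)) (hdiff m i j u),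
        pd_add p (hdiff j i m u) (hdiff i j m u), hdd, hdd, hdd]
    rw [funext (h1 l i j)]
    simp only [christoffelValue]
    rw [pd_const_mul p _ (DifferentiableAt.fun_sum fun m _ => (hinv l m).fun_mul (hl m)),
      pd_sum _ _ fun m _ => (hinv l m).fun_mul (hl m), christoffelDeriv]
    congr 1
    refine Finset.sum_congr rfl fun m _ => ?_
    rw [pd_mul p (hinv l m) (hl m), hpl,
      pd_inv_apply (fun i j => hg i j u) hu (d := d u) (fun p i j => hd u p i j)]
  simp only [scalarCurvature, curvatureValue, h1, h2, hX]

/-! ### Components of a vector in the moving frame of the sphere -/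

section SphereFrame

/-- The component of `a` along the unit normal of the sphere at `(θ, φ)`. -/
noncomputable def normalPart (a : Fin 3 → ℝ) (θ φ : ℝ) : ℝ :=
  a 0 * (Real.cos θ * Real.cos φ) + a 1 * (Real.sin θ * Real.cos φ) + a 2 * Real.sin φ

/-- The component of `a` along the unit tangent vector of the parallel through `(θ, φ)`. -/
noncomputable def eastPart (a : Fin 3 → ℝ) (θ : ℝ) : ℝ :=
  -(a 0 * Real.sin θ) + a 1 * Real.cos θ

/-- The component of `a` along the unit tangent vector of the meridian through `(θ, φ)`. -/
noncomputable def northPart (a : Fin 3 → ℝ) (θ φ : ℝ) : ℝ :=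
  -(a 0 * (Real.cos θ * Real.sin φ)) - a 1 * (Real.sin θ * Real.sin φ) + a 2 * Real.cos φ

variable (a : Fin 3 → ℝ) (θ φ : ℝ)

theorem hasDerivAt_normalPart_left :
    HasDerivAt (fun x => normalPart a x φ) (Real.cos φ * eastPart a θ) θ := by
  have hc := (Real.hasDerivAt_cos θ).mul_const (Real.cos φ)
  have hs := (Real.hasDerivAt_sin θ).mul_const (Real.cos φ)
  refine (((hc.const_mul (a 0)).add (hs.const_mul (a 1))).add_const
    (a 2 * Real.sin φ)).congr_deriv ?_
  rw [eastPart]; ring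

theorem hasDerivAt_normalPart_right :
    HasDerivAt (fun x => normalPart a θ x) (northPart a θ φ) φ := by
  have hc := Real.hasDerivAt_cos φ
  have hs := Real.hasDerivAt_sin φ
  refine ((((hc.const_mul (Real.cos θ)).const_mul (a 0)).add
    ((hc.const_mul (Real.sin θ)).const_mul (a 1))).add (hs.const_mul (a 2))).congr_deriv ?_
  rw [northPart]; ring

theorem hasDerivAt_eastPart :
    HasDerivAt (fun x => eastPart a x)
      (-Real.cos φ * normalPart a θ φ + Real.sin φ * northPart a θ φ) θ := by
  refine (((Real.hasDerivAt_sin θ).const_mul (a 0)).neg.add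
    ((Real.hasDerivAt_cos θ).const_mul (a 1))).congr_deriv ?_
  rw [normalPart, northPart]
  linear_combination (a 0 * Real.cos θ + a 1 * Real.sin θ) * Real.sin_sq_add_cos_sq φ

theorem hasDerivAt_northPart_left :
    HasDerivAt (fun x => northPart a x φ) (-Real.sin φ * eastPart a θ) θ := by
  have hc := (Real.hasDerivAt_cos θ).mul_const (Real.sin φ)
  have hs := (Real.hasDerivAt_sin θ).mul_const (Real.sin φ)
  refine (((hc.const_mul (a 0)).neg.sub (hs.const_mul (a 1))).add_const
    (a 2 * Real.cos φ)).congr_deriv ?_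
  rw [eastPart]; ring

theorem hasDerivAt_northPart_right :
    HasDerivAt (fun x => northPart a θ x) (-normalPart a θ φ) φ := by
  have hc := Real.hasDerivAt_cos φ
  have hs := Real.hasDerivAt_sin φ
  refine ((((hs.const_mul (Real.cos θ)).const_mul (a 0)).neg.sub
    ((hs.const_mul (Real.sin θ)).const_mul (a 1))).add (hc.const_mul (a 2))).congr_deriv ?_
  rw [normalPart]; ring

theorem differentiable_normalPart :
    Differentiable ℝ fun v : Fin 3 → ℝ => normalPart a (v 1) (v 2) := by
  unfold normalPart; fun_prop

theorem differentiable_eastPart :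
    Differentiable ℝ fun v : Fin 3 → ℝ => eastPart a (v 1) := by
  unfold eastPart; fun_prop

theorem differentiable_northPart :
    Differentiable ℝ fun v : Fin 3 → ℝ => northPart a (v 1) (v 2) := by
  unfold northPart; fun_prop

end SphereFrame

/-! ### The metric of the kinematic surface and its first derivatives -/

section Metric

variable (al s k : ℝ) (q w : Fin 3 → ℝ)

/-- The first fundamental form of the kinematic surface. -/
noncomputable def metric (v : Fin 3 → ℝ) : Matrix (Fin 3) (Fin 3) ℝ :=
  symMatrix (al + 2 * normalPart q (v 1) (v 2))
    (Real.cos (v 2) * (northPart w (v 1) (v 2) + v 0 * eastPart q (v 1)))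
    (-eastPart w (v 1) + v 0 * northPart q (v 1) (v 2))
    (((1 + v 0 * s) ^ 2 + k * v 0 ^ 2) * Real.cos (v 2) ^ 2) 0
    ((1 + v 0 * s) ^ 2 + k * v 0 ^ 2)

/-- The partial derivatives of `metric`. -/
noncomputable def metricDeriv (v : Fin 3 → ℝ) : Fin 3 → Matrix (Fin 3) (Fin 3) ℝ :=
  ![symMatrix 0 (Real.cos (v 2) * eastPart q (v 1)) (northPart q (v 1) (v 2))
      ((2 * s * (1 + v 0 * s) + 2 * k * v 0) * Real.cos (v 2) ^ 2) 0
      (2 * s * (1 + v 0 * s) + 2 * k * v 0),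
    symMatrix (2 * (Real.cos (v 2) * eastPart q (v 1)))
      (Real.cos (v 2) * (-Real.sin (v 2) * eastPart w (v 1) + v 0 *
        (-Real.cos (v 2) * normalPart q (v 1) (v 2) + Real.sin (v 2) * northPart q (v 1) (v 2))))
      (-(-Real.cos (v 2) * normalPart w (v 1) (v 2) + Real.sin (v 2) * northPart w (v 1) (v 2))
        + v 0 * (-Real.sin (v 2) * eastPart q (v 1))) 0 0 0,
    symMatrix (2 * northPart q (v 1) (v 2))
      (-Real.sin (v 2) * (northPart w (v 1) (v 2) + v 0 * eastPart q (v 1)) +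
        Real.cos (v 2) * -normalPart w (v 1) (v 2))
      (v 0 * -normalPart q (v 1) (v 2))
      (((1 + v 0 * s) ^ 2 + k * v 0 ^ 2) * (-2 * Real.cos (v 2) * Real.sin (v 2))) 0 0]

theorem differentiable_metric (i j : Fin 3) :
    Differentiable ℝ fun v => metric al s k q w v i j := by
  have h1 := differentiable_normalPart q
  have h2 := differentiable_eastPart q
  have h3 := differentiable_northPart q
  have h4 := differentiable_eastPart w
  have h5 := differentiable_northPart w
  fin_cases i <;> fin_cases j <;> simp [metric] <;> fun_prop

theorem differentiable_metricDeriv (p i j : Fin 3) :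
    Differentiable ℝ fun v => metricDeriv s k q w v p i j := by
  have h1 := differentiable_normalPart q
  have h2 := differentiable_eastPart q
  have h3 := differentiable_northPart q
  have h4 := differentiable_eastPart w
  have h5 := differentiable_northPart w
  have h6 := differentiable_normalPart w
  fin_cases p <;> fin_cases i <;> fin_cases j <;> simp [metricDeriv] <;> fun_prop

theorem hasDerivAt_scaleSq (t : ℝ) :
    HasDerivAt (fun x => (1 + x * s) ^ 2 + k * x ^ 2) (2 * s * (1 + t * s) + 2 * k * t) t := by
  refine (((((hasDerivAt_id t).mul_const s).const_add 1).pow 2).add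
    (((hasDerivAt_id t).pow 2).const_mul k)).congr_deriv ?_
  simp; ring

theorem pd_metric (v : Fin 3 → ℝ) (p i j : Fin 3) :
    pd p (fun v => metric al s k q w v i j) v = metricDeriv s k q w v p i j := by
  refine pd_eq_of_hasDerivAt (differentiable_metric al s k q w i j v) ?_
  have hid := hasDerivAt_id (v 0)
  have hsc := hasDerivAt_scaleSq s k (v 0)
  have hc := Real.hasDerivAt_cos (v 2)
  have hq1 := hasDerivAt_normalPart_left q (v 1) (v 2)
  have hq2 := hasDerivAt_normalPart_right q (v 1) (v 2)
  have hq3 := hasDerivAt_eastPart q (v 1) (v 2)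
  have hq4 := hasDerivAt_northPart_left q (v 1) (v 2)
  have hq5 := hasDerivAt_northPart_right q (v 1) (v 2)
  have hw3 := hasDerivAt_eastPart w (v 1) (v 2)
  have hw4 := hasDerivAt_northPart_left w (v 1) (v 2)
  have hw5 := hasDerivAt_northPart_right w (v 1) (v 2)
  have t01 : HasDerivAt (fun x => Real.cos (v 2) * (northPart w (v 1) (v 2) + x * eastPart q (v 1)))
      (Real.cos (v 2) * eastPart q (v 1)) (v 0) :=
    (((hid.mul_const _).const_add _).const_mul _).congr_deriv (by simp)
  have t02 : HasDerivAt (fun x => -eastPart w (v 1) + x * northPart q (v 1) (v 2))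
      (northPart q (v 1) (v 2)) (v 0) :=
    ((hid.mul_const _).const_add _).congr_deriv (by simp)
  have t11 := hsc.mul_const (Real.cos (v 2) ^ 2)
  have a00 := (hq1.const_mul 2).const_add al
  have a01 := (hw4.add (hq3.const_mul (v 0))).const_mul (Real.cos (v 2))
  have a02 := hw3.neg.add (hq4.const_mul (v 0))
  have b00 := (hq2.const_mul 2).const_add al
  have b01 := hc.mul (hw5.add_const (v 0 * eastPart q (v 1)))
  have b02 : HasDerivAt (fun x => -eastPart w (v 1) + v 0 * northPart q (v 1) x)
      (v 0 * -normalPart q (v 1) (v 2)) (v 2) := (hq5.const_mul (v 0)).const_add _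
  have b11 : HasDerivAt (fun x => ((1 + v 0 * s) ^ 2 + k * v 0 ^ 2) * Real.cos x ^ 2)
      (((1 + v 0 * s) ^ 2 + k * v 0 ^ 2) * (-2 * Real.cos (v 2) * Real.sin (v 2))) (v 2) :=
    ((hc.pow 2).const_mul _).congr_deriv (by simp)
  fin_cases p <;> fin_cases i <;> fin_cases j <;>
    simp only [metric, metricDeriv, Fin.zero_eta, Fin.mk_one, Fin.reduceFinMk, Matrix.cons_val,
      symMatrix_zero_zero, symMatrix_zero_one, symMatrix_zero_two, symMatrix_one_zero,
      symMatrix_one_one, symMatrix_one_two, symMatrix_two_zero, symMatrix_two_one,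
      symMatrix_two_two, Function.update_self, ne_eq, Fin.reduceEq, not_false_eq_true,
      Function.update_of_ne] <;>
    first
      | exact hasDerivAt_const _ _ | exact hsc | exact t01 | exact t02 | exact t11 | exact a00
      | exact a01 | exact a02 | exact b00 | exact b01 | exact b02 | exact b11

end Metric

/-! ### The 2-jet of the metric at t = 0 and the curvature formula -/

section MetricAtZero

variable (al s k : ℝ) (q w : Fin 3 → ℝ) (θ φ : ℝ)

/-- The second partial derivatives of `metric` at `t = 0`. -/
noncomputable def metricDerivTwo : Fin 3 → Fin 3 → Matrix (Fin 3) (Fin 3) ℝ :=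
  ![![symMatrix 0 0 0 ((2 * s * s + 2 * k) * Real.cos φ ^ 2) 0 (2 * s * s + 2 * k),
      symMatrix 0 (Real.cos φ * (-Real.cos φ * normalPart q θ φ + Real.sin φ * northPart q θ φ))
        (-Real.sin φ * eastPart q θ) 0 0 0,
      symMatrix 0 (-Real.sin φ * eastPart q θ) (-normalPart q θ φ)
        (2 * s * (-2 * Real.cos φ * Real.sin φ)) 0 0],
    ![symMatrix 0 (Real.cos φ * (-Real.cos φ * normalPart q θ φ + Real.sin φ * northPart q θ φ))
        (-Real.sin φ * eastPart q θ) 0 0 0,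
      symMatrix
        (2 * (Real.cos φ * (-Real.cos φ * normalPart q θ φ + Real.sin φ * northPart q θ φ)))
        (Real.cos φ * (-Real.sin φ *
          (-Real.cos φ * normalPart w θ φ + Real.sin φ * northPart w θ φ)))
        (-(-Real.cos φ * (Real.cos φ * eastPart w θ) +
          Real.sin φ * (-Real.sin φ * eastPart w θ))) 0 0 0,
      symMatrix (2 * (-Real.sin φ * eastPart q θ))
        (-Real.sin φ * (-Real.sin φ * eastPart w θ) +
          Real.cos φ * -(Real.cos φ * eastPart w θ)) 0 0 0 0],
    ![symMatrix 0 (-Real.sin φ * eastPart q θ) (-normalPart q θ φ)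
        (2 * s * (-2 * Real.cos φ * Real.sin φ)) 0 0,
      symMatrix (2 * (-Real.sin φ * eastPart q θ))
        (-Real.sin φ * (-Real.sin φ * eastPart w θ) +
          Real.cos φ * -(Real.cos φ * eastPart w θ)) 0 0 0 0,
      symMatrix (2 * -normalPart q θ φ)
        (-Real.cos φ * northPart w θ φ + -Real.sin φ * -normalPart w θ φ +
          (-Real.sin φ * -normalPart w θ φ + Real.cos φ * -northPart w θ φ)) 0
        (-2 * -Real.sin φ * Real.sin φ + -2 * Real.cos φ * Real.cos φ) 0 0]]

theorem pd_metricDeriv (p r i j : Fin 3) :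
    pd p (fun v => metricDeriv s k q w v r i j) ![0, θ, φ] = metricDerivTwo s k q w θ φ p r i j := by
  refine pd_eq_of_hasDerivAt (differentiable_metricDeriv s k q w r i j _) ?_
  have hid := hasDerivAt_id (0 : ℝ)
  have hsc := hasDerivAt_scaleSq s k 0
  have hc := Real.hasDerivAt_cos φ
  have hs := Real.hasDerivAt_sin φ
  have hq1 := hasDerivAt_normalPart_left q θ φ
  have hq2 := hasDerivAt_normalPart_right q θ φ
  have hq3 := hasDerivAt_eastPart q θ φ
  have hq4 := hasDerivAt_northPart_left q θ φ
  have hq5 := hasDerivAt_northPart_right q θ φ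
  have hw1 := hasDerivAt_normalPart_left w θ φ
  have hw2 := hasDerivAt_normalPart_right w θ φ
  have hw3 := hasDerivAt_eastPart w θ φ
  have hw4 := hasDerivAt_northPart_left w θ φ
  have hw5 := hasDerivAt_northPart_right w θ φ
  have lin : ∀ a b : ℝ, HasDerivAt (fun x => a + x * b) b 0 := fun a b =>
    ((hid.mul_const b).const_add a).congr_deriv (by simp)
  have lin' : ∀ b : ℝ, HasDerivAt (fun x => x * b) b 0 := fun b =>
    (hid.mul_const b).congr_deriv (by simp)
  have lint : HasDerivAt (fun x => 2 * s * (1 + x * s) + 2 * k * x) (2 * s * s + 2 * k) 0 :=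
    (((lin 1 s).const_mul (2 * s)).add (hid.const_mul (2 * k))).congr_deriv (by simp)
  have h0011 := lint.mul_const (Real.cos φ ^ 2)
  have h0101 := (lin (-Real.sin φ * eastPart w θ)
    (-Real.cos φ * normalPart q θ φ + Real.sin φ * northPart q θ φ)).const_mul (Real.cos φ)
  have h0102 := lin (-(-Real.cos φ * normalPart w θ φ + Real.sin φ * northPart w θ φ))
    (-Real.sin φ * eastPart q θ)
  have h0201 : HasDerivAt (fun x => -Real.sin φ * (northPart w θ φ + x * eastPart q θ) +
      Real.cos φ * -normalPart w θ φ) (-Real.sin φ * eastPart q θ) 0 :=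
    ((lin (northPart w θ φ) (eastPart q θ)).const_mul _).add_const _
  have h0202 := lin' (-normalPart q θ φ)
  have h0211 : HasDerivAt
      (fun x => ((1 + x * s) ^ 2 + k * x ^ 2) * (-2 * Real.cos φ * Real.sin φ))
      (2 * s * (-2 * Real.cos φ * Real.sin φ)) 0 := (hsc.mul_const _).congr_deriv (by simp)
  have h1001 := hq3.const_mul (Real.cos φ)
  have h1100 := h1001.const_mul 2
  have h1101 := (hw3.const_mul (-Real.sin φ)).const_mul (Real.cos φ)
  have h1102 := ((hw1.const_mul (-Real.cos φ)).add (hw4.const_mul (Real.sin φ))).neg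
  have h1200 := hq4.const_mul 2
  have h1201 := (hw4.const_mul (-Real.sin φ)).add (hw1.neg.const_mul (Real.cos φ))
  have h2001 := hc.mul_const (eastPart q θ)
  have h2011 : HasDerivAt (fun x => 2 * s * Real.cos x ^ 2)
      (2 * s * (-2 * Real.cos φ * Real.sin φ)) φ :=
    ((hc.pow 2).const_mul (2 * s)).congr_deriv (by simp)
  have h2100 := h2001.const_mul 2
  have h2101 : HasDerivAt (fun x => Real.cos x * (-Real.sin x * eastPart w θ))
      (-Real.sin φ * (-Real.sin φ * eastPart w θ) + Real.cos φ * -(Real.cos φ * eastPart w θ)) φ :=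
    (hc.mul (hs.neg.mul_const (eastPart w θ))).congr_deriv (by simp)
  have h2102 : HasDerivAt (fun x => -(-Real.cos x * normalPart w θ x + Real.sin x * northPart w θ x))
      0 φ := (((hc.neg.mul hw2).add (hs.mul hw5)).neg).congr_deriv (by simp)
  have h2200 := hq5.const_mul 2
  have h2201 := (hs.neg.mul hw5).add (hc.mul hw2.neg)
  have h2211 := (hc.const_mul (-2)).mul hs
  have e1 : Function.update (![0, θ, φ] : Fin 3 → ℝ) 0 = fun x => ![x, θ, φ] := by
    funext x i; fin_cases i <;> simp
  have e2 : Function.update (![0, θ, φ] : Fin 3 → ℝ) 1 = fun x => ![0, x, φ] := by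
    funext x i; fin_cases i <;> simp
  have e3 : Function.update (![0, θ, φ] : Fin 3 → ℝ) 2 = fun x => ![0, θ, x] := by
    funext x i; fin_cases i <;> simp
  fin_cases p <;> fin_cases r <;> fin_cases i <;> fin_cases j <;>
    simp only [e1, e2, e3, metricDeriv, metricDerivTwo, Fin.zero_eta, Fin.mk_one, Fin.reduceFinMk,
      Matrix.cons_val,
      symMatrix_zero_zero, symMatrix_zero_one, symMatrix_zero_two, symMatrix_one_zero,
      symMatrix_one_one, symMatrix_one_two, symMatrix_two_zero, symMatrix_two_one,
      symMatrix_two_two, zero_mul, mul_zero, add_zero, ne_eq, OfNat.ofNat_ne_zero,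
      not_false_eq_true, zero_pow, one_pow, mul_one, one_mul] <;>
    first
      | exact hasDerivAt_const _ _ | exact lint | exact h0011 | exact h0101 | exact h0102
      | exact h0201 | exact h0202 | exact h0211 | exact h1001 | exact hq4 | exact h1100
      | exact h1101 | exact h1102 | exact h1200 | exact h1201 | exact h2001 | exact hq5
      | exact h2011 | exact h2100 | exact h2101 | exact h2102 | exact h2200 | exact h2201
      | exact h2211

/-- The determinant of the first fundamental form at `t = 0` is `gramFactor * cos φ ^ 2`. -/
noncomputable def gramFactor : ℝ :=
  al + 2 * normalPart q θ φ - northPart w θ φ ^ 2 - eastPart w θ ^ 2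

theorem det_metric :
    (metric al s k q w ![0, θ, φ]).det = gramFactor al q w θ φ * Real.cos φ ^ 2 := by
  rw [Matrix.det_fin_three]
  simp [metric, gramFactor]
  ring

theorem inv_metric (hC : Real.cos φ ≠ 0) (hD : gramFactor al q w θ φ ≠ 0) :
    (metric al s k q w ![0, θ, φ])⁻¹ = Matrix.of fun i j =>
      modelInverse (eastPart w θ) (northPart w θ φ) (gramFactor al q w θ φ)⁻¹ i j /
        ((![1, Real.cos φ, 1] : Fin 3 → ℝ) i * (![1, Real.cos φ, 1] : Fin 3 → ℝ) j) := by
  -- Eliminating `al` makes the Gram factor an atom that `field_simp` can cancel.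
  have hal : al = gramFactor al q w θ φ - 2 * normalPart q θ φ + northPart w θ φ ^ 2
      + eastPart w θ ^ 2 := by rw [gramFactor]; ring
  set D := gramFactor al q w θ φ
  rw [hal]
  refine Matrix.inv_eq_right_inv ?_
  ext i j
  rw [Matrix.mul_apply]
  fin_cases i <;> fin_cases j <;>
    simp [metric, modelInverse, Fin.sum_univ_three] <;> field_simp <;> ring

theorem metricDeriv_eq_model (hC : Real.cos φ ≠ 0) :
    metricDeriv s k q w ![0, θ, φ] = fun p => Matrix.of fun i j =>
      (![1, Real.cos φ, 1] : Fin 3 → ℝ) p * (![1, Real.cos φ, 1] : Fin 3 → ℝ) i *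
        (![1, Real.cos φ, 1] : Fin 3 → ℝ) j *
        modelDeriv (Real.sin φ / Real.cos φ) s (eastPart q θ) (northPart q θ φ)
          (normalPart w θ φ) (eastPart w θ) (northPart w θ φ) p i j := by
  funext p
  ext i j
  fin_cases p <;> fin_cases i <;> fin_cases j <;> simp [metricDeriv, modelDeriv] <;>
    field_simp <;> ring

theorem metricDerivTwo_eq_model (hC : Real.cos φ ≠ 0) :
    metricDerivTwo s k q w θ φ = fun p r => Matrix.of fun i j =>
      (![1, Real.cos φ, 1] : Fin 3 → ℝ) p * (![1, Real.cos φ, 1] : Fin 3 → ℝ) r *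
        (![1, Real.cos φ, 1] : Fin 3 → ℝ) i * (![1, Real.cos φ, 1] : Fin 3 → ℝ) j *
        modelDerivTwo (Real.sin φ / Real.cos φ) s k (normalPart q θ φ) (eastPart q θ)
          (northPart q θ φ) (normalPart w θ φ) (eastPart w θ) (northPart w θ φ) p r i j := by
  -- With sin φ = T cos φ and T an independent variable, every entry becomes a polynomial identity;
  -- sin² + cos² = 1 is not used.
  have hS : Real.sin φ = Real.sin φ / Real.cos φ * Real.cos φ := (div_mul_cancel₀ _ hC).symm
  rw [metricDerivTwo]
  generalize Real.sin φ / Real.cos φ = T at hS ⊢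
  rw [hS]
  funext p r
  ext i j
  fin_cases p <;> fin_cases r <;> fin_cases i <;> fin_cases j <;>
    simp only [modelDerivTwo, Fin.zero_eta, Fin.mk_one, Fin.reduceFinMk, Matrix.cons_val,
      Matrix.of_apply, symMatrix_zero_zero, symMatrix_zero_one, symMatrix_zero_two,
      symMatrix_one_zero, symMatrix_one_one, symMatrix_one_two, symMatrix_two_zero,
      symMatrix_two_one, symMatrix_two_two] <;> ring

theorem scalarCurvature_of_firstForm_eq {X : (Fin 3 → ℝ) → Fin 7 → ℝ}
    (hX : ∀ v, firstForm X v = metric al s k q w v)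
    (hdet : (firstForm X ![0, θ, φ]).det ≠ 0) :
    (scalarCurvature X ![0, θ, φ] - 2) * gramFactor al q w θ φ ^ 2 =
      -gramFactor al q w θ φ *
        (2 * s ^ 2 + 4 * k + 2 * (eastPart w θ ^ 2 + northPart w θ φ ^ 2)
          - 4 * normalPart w θ φ ^ 2)
      + (4 * s * (s * (eastPart w θ ^ 2 + northPart w θ φ ^ 2)
          - 2 * (northPart w θ φ * eastPart q θ - eastPart w θ * northPart q θ φ))
        + 2 * (eastPart q θ ^ 2 + northPart q θ φ ^ 2)
        + 4 * normalPart w θ φ * (eastPart w θ * eastPart q θ + northPart w θ φ * northPart q θ φ)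
        + 2 * normalPart w θ φ ^ 2 * (eastPart w θ ^ 2 + northPart w θ φ ^ 2)) := by
  rw [hX] at hdet
  have hdet' := hdet
  rw [det_metric] at hdet'
  have hD := left_ne_zero_of_mul hdet'
  have hC : Real.cos φ ≠ 0 := fun h => hdet' (by simp [h])
  have hc : ∀ i, (![1, Real.cos φ, 1] : Fin 3 → ℝ) i ≠ 0 := by
    intro i; fin_cases i <;> simp [hC]
  rw [scalarCurvature_eq_curvatureValue hX (differentiable_metric al s k q w)
    (pd_metric al s k q w) (differentiable_metricDeriv s k q w)
    (pd_metricDeriv s k q w θ φ) hdet, inv_metric al s k q w θ φ hC hD,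
    metricDeriv_eq_model s k q w θ φ hC, metricDerivTwo_eq_model s k q w θ φ hC,
    curvatureValue_scale _ hc, curvatureValue_model]
  field_simp
  ring

end MetricAtZero

/-! ### From the motion to the metric -/

/-- The inclusion of the coordinate `3`-space. -/
def embed (x : Fin 3 → ℝ) : Fin 7 → ℝ := ![x 0, x 1, x 2, 0, 0, 0, 0]

theorem sphere_eq_embed (θ φ : ℝ) : sphere θ φ =
    embed ![Real.cos θ * Real.cos φ, Real.sin θ * Real.cos φ, Real.sin φ] := rfl

/-- A kernel vector of the Gram matrix gives a combination of the tangent vectors orthogonal to all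
of them, hence to itself, hence zero. -/
theorem det_firstForm_ne_zero {X : (Fin 3 → ℝ) → Fin 7 → ℝ} {u : Fin 3 → ℝ}
    (h : RegularAt X u) : (firstForm X u).det ≠ 0 := by
  intro hdet
  obtain ⟨c, hc, hGc⟩ := Matrix.exists_mulVec_eq_zero_iff.2 hdet
  set Y : Fin 7 → ℝ := ∑ i, c i • pd i X u with hY
  have h1 : ∀ i, pd i X u ⬝ᵥ Y = 0 := by
    intro i
    have := congrFun hGc i
    simp only [Matrix.mulVec, dotProduct, firstForm, Matrix.of_apply, Pi.zero_apply] at this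
    rw [hY, dotProduct_sum, ← this]
    refine Finset.sum_congr rfl fun j _ => ?_
    rw [dotProduct_smul, smul_eq_mul, mul_comm]; rfl
  have h2 : Y ⬝ᵥ Y = 0 := by
    nth_rw 1 [hY]
    rw [sum_dotProduct]
    refine Finset.sum_eq_zero fun i _ => ?_
    rw [smul_dotProduct, h1, smul_zero]
  have h3 : Y = 0 := dotProduct_self_eq_zero.1 h2
  exact hc (funext fun i => Fintype.linearIndependent_iff.1 h c h3 i)

namespace EquiformMotion

variable (M : EquiformMotion)

/-- Differentiate A Aᵀ = 1 at t = 0, where A is the identity. -/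
theorem Omega_skew (i j : Fin 7) : M.Omega i j = -M.Omega j i := by
  have hI : M.I ∈ nhds (0 : ℝ) := M.isOpen_I.mem_nhds M.zero_mem_I
  have hA : ∀ i j, HasDerivAt (fun t => M.A t i j) (M.Omega i j) 0 := fun i j =>
    (((M.A_contDiffOn i j).contDiffAt hI).differentiableAt one_ne_zero).hasDerivAt
  have h1 : (fun t => ∑ k, M.A t i k * M.A t j k) =ᶠ[nhds 0]
      fun _ => (1 : Matrix (Fin 7) (Fin 7) ℝ) i j := by
    filter_upwards [hI] with t ht
    have h2 := (Matrix.mem_specialOrthogonalGroup_iff.1 (M.A_mem t ht)).1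
    rw [Matrix.mem_orthogonalGroup_iff] at h2
    rw [← h2, Matrix.mul_apply]
    rfl
  have h3 : HasDerivAt (fun t => ∑ k, M.A t i k * M.A t j k)
      (∑ k, (M.Omega i k * M.A 0 j k + M.A 0 i k * M.Omega j k)) 0 :=
    HasDerivAt.fun_sum fun k _ => (hA i k).mul (hA j k)
  have h4 := h3.unique ((hasDerivAt_const (0 : ℝ) _).congr_of_eventuallyEq h1)
  rw [M.A_zero] at h4
  simp only [Finset.sum_add_distrib, Matrix.one_apply, mul_ite, ite_mul, mul_one, one_mul,
    mul_zero, zero_mul, Finset.sum_ite_eq, Finset.mem_univ, if_true] at h4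
  linarith

/-- The axial vector of the restriction of `Ω` to the coordinate `3`-space. -/
noncomputable def axis : Fin 3 → ℝ := ![-M.Omega 1 2, M.Omega 0 2, -M.Omega 0 1]

/-- The projection of `-Ω b'` to the coordinate `3`-space. -/
noncomputable def drift : Fin 3 → ℝ :=
  ![∑ i, M.bPrime i * M.Omega i 0, ∑ i, M.bPrime i * M.Omega i 1, ∑ i, M.bPrime i * M.Omega i 2]

/-- The squared length of the first column of `Ω`. -/
noncomputable def stretch : ℝ := ∑ i, M.Omega i 0 ^ 2

theorem bPrime_dotProduct_embed (h : M.NoTranslation) (x : Fin 3 → ℝ) :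
    M.bPrime ⬝ᵥ embed x = 0 := by
  obtain ⟨h0, h1, h2⟩ := h
  simp [dotProduct, embed, Fin.sum_univ_seven, h0, h1, h2]

theorem bPrime_dotProduct_Omega (x : Fin 3 → ℝ) :
    M.bPrime ⬝ᵥ (M.Omega *ᵥ embed x) = M.drift ⬝ᵥ x := by
  simp [Matrix.mulVec, dotProduct, embed, Fin.sum_univ_seven, Fin.sum_univ_three, drift]
  ring

theorem embed_dotProduct_embed (x y : Fin 3 → ℝ) : embed x ⬝ᵥ embed y = x ⬝ᵥ y := by
  simp [dotProduct, embed, Fin.sum_univ_seven, Fin.sum_univ_three]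

/-- The compression of Ω to the 3-space is skew, hence acts as a cross product with its axial
vector. -/
theorem embed_dotProduct_Omega (x y : Fin 3 → ℝ) :
    embed x ⬝ᵥ (M.Omega *ᵥ embed y) = M.axis ⬝ᵥ crossProduct y x := by
  have h0 : M.Omega 0 0 = 0 := by linarith [M.Omega_skew 0 0]
  have h1 : M.Omega 1 1 = 0 := by linarith [M.Omega_skew 1 1]
  have h2 : M.Omega 2 2 = 0 := by linarith [M.Omega_skew 2 2]
  rw [cross_apply]
  simp [Matrix.mulVec, dotProduct, embed, Fin.sum_univ_seven, Fin.sum_univ_three, axis, h0, h1, h2,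
    M.Omega_skew 1 0, M.Omega_skew 2 0, M.Omega_skew 2 1]
  ring

/-- By skewness, the sums over rows in the sphere conditions, with their common terms cancelled, are
sums over columns. -/
theorem column_orthogonality (h : M.FoliatedBySpheres) :
    (∑ i, M.Omega i 0 * M.Omega i 1 = 0) ∧ (∑ i, M.Omega i 0 * M.Omega i 2 = 0) ∧
    (∑ i, M.Omega i 1 * M.Omega i 2 = 0) ∧ (∑ i, M.Omega i 1 ^ 2 = M.stretch) ∧
    (∑ i, M.Omega i 2 ^ 2 = M.stretch) := by
  have h0 : M.Omega 0 0 = 0 := by linarith [M.Omega_skew 0 0]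
  have h1 : M.Omega 1 1 = 0 := by linarith [M.Omega_skew 1 1]
  have h2 : M.Omega 2 2 = 0 := by linarith [M.Omega_skew 2 2]
  have e2 : Finset.Ici (2 : Fin 7) = {2, 3, 4, 5, 6} := by decide
  have e3 : Finset.Ici (3 : Fin 7) = {3, 4, 5, 6} := by decide
  obtain ⟨a, b, c, d, e⟩ := h
  simp [e2, e3] at a b c d e
  simp only [stretch, Fin.sum_univ_seven, h0, h1, h2, M.Omega_skew 1 0, M.Omega_skew 2 0,
    M.Omega_skew 2 1, M.Omega_skew 3 _, M.Omega_skew 4 _, M.Omega_skew 5 _, M.Omega_skew 6 _]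
  refine ⟨?_, ?_, ?_, ?_, ?_⟩
  · linear_combination a
  · linear_combination -b
  · linear_combination c
  · linear_combination -d
  · linear_combination -e

theorem Omega_dotProduct_Omega (h : M.FoliatedBySpheres) (x y : Fin 3 → ℝ) :
    (M.Omega *ᵥ embed x) ⬝ᵥ (M.Omega *ᵥ embed y) = M.stretch * (x ⬝ᵥ y) := by
  obtain ⟨a, b, c, d, e⟩ := M.column_orthogonality h
  have h1 : ∀ z i, (M.Omega *ᵥ embed z) i =
      M.Omega i 0 * z 0 + M.Omega i 1 * z 1 + M.Omega i 2 * z 2 := by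
    intro z i
    simp [Matrix.mulVec, dotProduct, embed, Fin.sum_univ_seven]
  have h2 : ∀ i, (M.Omega *ᵥ embed x) i * (M.Omega *ᵥ embed y) i =
      M.Omega i 0 ^ 2 * (x 0 * y 0) + M.Omega i 1 ^ 2 * (x 1 * y 1) + M.Omega i 2 ^ 2 * (x 2 * y 2)
      + M.Omega i 0 * M.Omega i 1 * (x 0 * y 1 + x 1 * y 0)
      + M.Omega i 0 * M.Omega i 2 * (x 0 * y 2 + x 2 * y 0)
      + M.Omega i 1 * M.Omega i 2 * (x 1 * y 2 + x 2 * y 1) := by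
    intro i
    rw [h1, h1]; ring
  rw [dotProduct]
  simp only [h2, Finset.sum_add_distrib, ← Finset.sum_mul, a, b, c, d, e]
  simp only [dotProduct, Fin.sum_univ_three, stretch]
  ring

/-- Sum |w × rᵢ|² over the rows rᵢ of the first three columns of Ω. Those columns are orthogonal of
squared length k, so all seven rows give 2|w|²k. The first three rows form a skew block whose rows
are orthogonal to w, and give 2|w|⁴. The other terms are nonnegative. The common factor |w|² is
kept, so w = 0 needs no separate treatment. -/
theorem sq_axis_le (h : M.FoliatedBySpheres) :
    (M.axis ⬝ᵥ M.axis) * (M.axis ⬝ᵥ M.axis) ≤ (M.axis ⬝ᵥ M.axis) * M.stretch := by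
  obtain ⟨a, b, c, d, e⟩ := M.column_orthogonality h
  have h0 : M.Omega 0 0 = 0 := by linarith [M.Omega_skew 0 0]
  have h1 : M.Omega 1 1 = 0 := by linarith [M.Omega_skew 1 1]
  have h2 : M.Omega 2 2 = 0 := by linarith [M.Omega_skew 2 2]
  set F : Fin 7 → ℝ := fun i => (M.axis 1 * M.Omega i 2 - M.axis 2 * M.Omega i 1) ^ 2 +
    (M.axis 2 * M.Omega i 0 - M.axis 0 * M.Omega i 2) ^ 2 +
    (M.axis 0 * M.Omega i 1 - M.axis 1 * M.Omega i 0) ^ 2 with hF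
  have hnn : ∀ i, 0 ≤ F i := fun i => by simp only [hF]; positivity
  have hsum : ∑ i, F i = 2 * (M.axis ⬝ᵥ M.axis) * M.stretch := by
    have h3 : ∀ i, F i = M.Omega i 0 ^ 2 * (M.axis 1 ^ 2 + M.axis 2 ^ 2)
        + M.Omega i 1 ^ 2 * (M.axis 0 ^ 2 + M.axis 2 ^ 2)
        + M.Omega i 2 ^ 2 * (M.axis 0 ^ 2 + M.axis 1 ^ 2)
        + M.Omega i 0 * M.Omega i 1 * (-2 * M.axis 0 * M.axis 1)
        + M.Omega i 0 * M.Omega i 2 * (-2 * M.axis 0 * M.axis 2)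
        + M.Omega i 1 * M.Omega i 2 * (-2 * M.axis 1 * M.axis 2) := by
      intro i; simp only [hF]; ring
    simp only [h3, Finset.sum_add_distrib, ← Finset.sum_mul, a, b, c, d, e]
    simp only [dotProduct, Fin.sum_univ_three, stretch]
    ring
  have hrow : F 0 + F 1 + F 2 = 2 * (M.axis ⬝ᵥ M.axis) * (M.axis ⬝ᵥ M.axis) := by
    simp [hF, dotProduct, Fin.sum_univ_three, axis, h0, h1, h2, M.Omega_skew 1 0,
      M.Omega_skew 2 0, M.Omega_skew 2 1]
    ring
  rw [Fin.sum_univ_seven] at hsum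
  linarith [hnn 3, hnn 4, hnn 5, hnn 6]

/-- The vectors which occur as partial derivatives of the kinematic surface. -/
noncomputable def tangentVector (a c e : ℝ) (x : Fin 3 → ℝ) : Fin 7 → ℝ :=
  a • embed x + c • M.Omega *ᵥ embed x + e • M.bPrime

/-- All entries of the metric are instances of this formula: conformality of Ω gives the k-term, and
the absence of translation removes the products of b' with the 3-space. -/
theorem tangentVector_dotProduct (h : M.FoliatedBySpheres) (h' : M.NoTranslation)
    (a c e a' c' e' : ℝ) (x y : Fin 3 → ℝ) :
    M.tangentVector a c e x ⬝ᵥ M.tangentVector a' c' e' y =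
      (a * a' + c * c' * M.stretch) * (x ⬝ᵥ y) + (c * a' - a * c') * (M.axis ⬝ᵥ crossProduct x y)
      + c * e' * (M.drift ⬝ᵥ x) + e * c' * (M.drift ⬝ᵥ y) + e * e' * (M.bPrime ⬝ᵥ M.bPrime) := by
  simp only [tangentVector, add_dotProduct, dotProduct_add, smul_dotProduct, dotProduct_smul,
    smul_eq_mul, embed_dotProduct_embed, M.embed_dotProduct_Omega,
    dotProduct_comm (M.Omega *ᵥ embed x) (embed y), M.Omega_dotProduct_Omega h,
    dotProduct_comm (M.Omega *ᵥ embed x) M.bPrime, dotProduct_comm (embed x) M.bPrime,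
    M.bPrime_dotProduct_embed h', M.bPrime_dotProduct_Omega]
  rw [← cross_anticomm x y, dotProduct_neg]
  ring

theorem surface_eq (v : Fin 3 → ℝ) :
    M.surface v = M.tangentVector (1 + v 0 * M.sPrime) (v 0) (v 0)
      ![Real.cos (v 1) * Real.cos (v 2), Real.sin (v 1) * Real.cos (v 2), Real.sin (v 2)] := by
  rw [surface, tangentVector, ← sphere_eq_embed, Matrix.add_mulVec, Matrix.one_mulVec,
    Matrix.smul_mulVec, Matrix.add_mulVec, Matrix.smul_mulVec, Matrix.one_mulVec]
  module

theorem differentiable_surface : Differentiable ℝ M.surface := by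
  rw [differentiable_pi]
  intro i
  simp only [surface_eq, tangentVector, Matrix.mulVec, dotProduct, Fin.sum_univ_seven, embed,
    Pi.add_apply, Pi.smul_apply, smul_eq_mul]
  fin_cases i <;> simp <;> fun_prop

theorem hasDerivAt_tangentVector (a c e : ℝ) {x : ℝ → Fin 3 → ℝ} {x' : Fin 3 → ℝ} {t : ℝ}
    (hx : HasDerivAt x x' t) :
    HasDerivAt (fun r => M.tangentVector a c e (x r)) (M.tangentVector a c 0 x') t := by
  rw [hasDerivAt_pi] at hx ⊢
  intro i
  have h : ∀ z, (M.Omega *ᵥ embed z) i =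
      M.Omega i 0 * z 0 + M.Omega i 1 * z 1 + M.Omega i 2 * z 2 := by
    intro z
    simp [Matrix.mulVec, dotProduct, embed, Fin.sum_univ_seven]
  have h2 : HasDerivAt (fun r => embed (x r) i) (embed x' i) t := by
    fin_cases i
    exacts [hx 0, hx 1, hx 2, hasDerivAt_const _ _, hasDerivAt_const _ _, hasDerivAt_const _ _,
      hasDerivAt_const _ _]
  simp only [tangentVector, Pi.add_apply, Pi.smul_apply, smul_eq_mul, h, zero_mul, add_zero]
  exact ((h2.const_mul a).add (((((hx 0).const_mul _).add ((hx 1).const_mul _)).add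
    ((hx 2).const_mul _)).const_mul c)).add_const _

theorem pd_surface_zero (v : Fin 3 → ℝ) :
    pd 0 M.surface v = M.tangentVector M.sPrime 1 1
      ![Real.cos (v 1) * Real.cos (v 2), Real.sin (v 1) * Real.cos (v 2), Real.sin (v 2)] := by
  refine pd_eq_of_hasDerivAt (M.differentiable_surface v) ?_
  simp only [surface_eq, tangentVector, Function.update_self, ne_eq, Fin.reduceEq,
    not_false_eq_true, Function.update_of_ne]
  have hid := hasDerivAt_id (v 0)
  exact ((((hid.mul_const M.sPrime).const_add 1).smul_const _).add (hid.smul_const _)).add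
    (hid.smul_const _) |>.congr_deriv (by simp)

theorem pd_surface_one (v : Fin 3 → ℝ) :
    pd 1 M.surface v = M.tangentVector (1 + v 0 * M.sPrime) (v 0) 0
      ![-Real.sin (v 1) * Real.cos (v 2), Real.cos (v 1) * Real.cos (v 2), 0] := by
  refine pd_eq_of_hasDerivAt (M.differentiable_surface v) ?_
  simp only [surface_eq, Function.update_self, ne_eq, Fin.reduceEq,
    not_false_eq_true, Function.update_of_ne]
  refine M.hasDerivAt_tangentVector _ _ _ (hasDerivAt_pi.2 fun i => ?_)
  fin_cases i
  exacts [(Real.hasDerivAt_cos _).mul_const _, (Real.hasDerivAt_sin _).mul_const _,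
    hasDerivAt_const _ _]

theorem pd_surface_two (v : Fin 3 → ℝ) :
    pd 2 M.surface v = M.tangentVector (1 + v 0 * M.sPrime) (v 0) 0
      ![Real.cos (v 1) * -Real.sin (v 2), Real.sin (v 1) * -Real.sin (v 2), Real.cos (v 2)] := by
  refine pd_eq_of_hasDerivAt (M.differentiable_surface v) ?_
  simp only [surface_eq, Function.update_self, ne_eq, Fin.reduceEq,
    not_false_eq_true, Function.update_of_ne]
  refine M.hasDerivAt_tangentVector _ _ _ (hasDerivAt_pi.2 fun i => ?_)
  fin_cases i
  exacts [(Real.hasDerivAt_cos _).const_mul _, (Real.hasDerivAt_cos _).const_mul _,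
    Real.hasDerivAt_sin _]

theorem firstForm_surface (h : M.FoliatedBySpheres) (h' : M.NoTranslation) (v : Fin 3 → ℝ) :
    firstForm M.surface v = metric (M.sPrime ^ 2 + M.stretch + M.bPrime ⬝ᵥ M.bPrime)
      M.sPrime M.stretch M.drift M.axis v := by
  have hθ := Real.sin_sq_add_cos_sq (v 1)
  have hφ := Real.sin_sq_add_cos_sq (v 2)
  have p0 := M.pd_surface_zero v
  have p1 := M.pd_surface_one v
  have p2 := M.pd_surface_two v
  set n : Fin 3 → ℝ :=
    ![Real.cos (v 1) * Real.cos (v 2), Real.sin (v 1) * Real.cos (v 2), Real.sin (v 2)] with hn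
  set a : Fin 3 → ℝ := ![-Real.sin (v 1) * Real.cos (v 2), Real.cos (v 1) * Real.cos (v 2), 0]
    with ha
  set b : Fin 3 → ℝ :=
    ![Real.cos (v 1) * -Real.sin (v 2), Real.sin (v 1) * -Real.sin (v 2), Real.cos (v 2)] with hb
  have nn : n ⬝ᵥ n = 1 := by
    simp [hn, dotProduct, Fin.sum_univ_three]
    linear_combination Real.cos (v 2) ^ 2 * hθ + hφ
  have na : n ⬝ᵥ a = 0 := by
    simp [hn, ha, dotProduct, Fin.sum_univ_three]
    ring
  have nb : n ⬝ᵥ b = 0 := by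
    simp [hn, hb, dotProduct, Fin.sum_univ_three]
    linear_combination -Real.cos (v 2) * Real.sin (v 2) * hθ
  have aa : a ⬝ᵥ a = Real.cos (v 2) ^ 2 := by
    simp [ha, dotProduct, Fin.sum_univ_three]
    linear_combination Real.cos (v 2) ^ 2 * hθ
  have ab : a ⬝ᵥ b = 0 := by
    simp [ha, hb, dotProduct, Fin.sum_univ_three]
    ring
  have bb : b ⬝ᵥ b = 1 := by
    simp [hb, dotProduct, Fin.sum_univ_three]
    linear_combination Real.sin (v 2) ^ 2 * hθ + hφ
  have cn : ∀ c : Fin 3 → ℝ, c ⬝ᵥ n = normalPart c (v 1) (v 2) := by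
    intro c; simp [hn, dotProduct, Fin.sum_univ_three, normalPart]
  have ca : ∀ c : Fin 3 → ℝ, c ⬝ᵥ a = Real.cos (v 2) * eastPart c (v 1) := by
    intro c; simp [ha, dotProduct, Fin.sum_univ_three, eastPart]; ring
  have cb : ∀ c : Fin 3 → ℝ, c ⬝ᵥ b = northPart c (v 1) (v 2) := by
    intro c; simp [hb, dotProduct, Fin.sum_univ_three, northPart]; ring
  -- The triad (east, north, normal) is right-handed and `a` is cos φ times the east vector, so
  -- normal × east = north and normal × north = -east turn the axis terms into frame components.
  have xa : crossProduct n a = Real.cos (v 2) • b := by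
    rw [cross_apply]
    ext i
    fin_cases i <;> simp [hn, ha, hb]
    · ring
    · ring
    · linear_combination Real.cos (v 2) ^ 2 * hθ
  have xb : crossProduct n b =
      fun i => (![Real.sin (v 1), -Real.cos (v 1), 0] : Fin 3 → ℝ) i := by
    rw [cross_apply]
    ext i
    fin_cases i <;> simp [hn, hb]
    · linear_combination Real.sin (v 1) * hφ
    · linear_combination -Real.cos (v 1) * hφ
    · ring
  have xb' : M.axis ⬝ᵥ crossProduct n b = -eastPart M.axis (v 1) := by
    rw [xb]; simp [dotProduct, Fin.sum_univ_three, eastPart]; ring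
  have xa' : M.axis ⬝ᵥ crossProduct n a = Real.cos (v 2) * northPart M.axis (v 1) (v 2) := by
    rw [xa, dotProduct_smul, smul_eq_mul, cb]
  have g00 : pd 0 M.surface v ⬝ᵥ pd 0 M.surface v = M.sPrime ^ 2 + M.stretch +
      M.bPrime ⬝ᵥ M.bPrime + 2 * normalPart M.drift (v 1) (v 2) := by
    rw [p0, M.tangentVector_dotProduct h h', nn, cn]; ring
  have g01 : pd 0 M.surface v ⬝ᵥ pd 1 M.surface v = Real.cos (v 2) *
      (northPart M.axis (v 1) (v 2) + v 0 * eastPart M.drift (v 1)) := by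
    rw [p0, p1, M.tangentVector_dotProduct h h', na, ca, xa']; ring
  have g02 : pd 0 M.surface v ⬝ᵥ pd 2 M.surface v =
      -eastPart M.axis (v 1) + v 0 * northPart M.drift (v 1) (v 2) := by
    rw [p0, p2, M.tangentVector_dotProduct h h', nb, cb, xb']; ring
  have g11 : pd 1 M.surface v ⬝ᵥ pd 1 M.surface v =
      ((1 + v 0 * M.sPrime) ^ 2 + M.stretch * v 0 ^ 2) * Real.cos (v 2) ^ 2 := by
    rw [p1, M.tangentVector_dotProduct h h', aa]; ring
  have g12 : pd 1 M.surface v ⬝ᵥ pd 2 M.surface v = 0 := by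
    rw [p1, p2, M.tangentVector_dotProduct h h', ab]; ring
  have g22 : pd 2 M.surface v ⬝ᵥ pd 2 M.surface v =
      (1 + v 0 * M.sPrime) ^ 2 + M.stretch * v 0 ^ 2 := by
    rw [p2, M.tangentVector_dotProduct h h', bb]; ring
  ext i j
  rw [firstForm, Matrix.of_apply]
  fin_cases i <;> fin_cases j
  exacts [g00, g01, g02, (dotProduct_comm _ _).trans g01, g11, g12,
    (dotProduct_comm _ _).trans g02, (dotProduct_comm _ _).trans g12, g22]

end EquiformMotion
-- The curvature equation as a polynomial identity on the sphere
/-- The numerator of `K - c` at `t = 0`, in terms of `x = w ⬝ᵥ n`, `y = q ⬝ᵥ n`, `z = q ⬝ᵥ (w × n)`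
for a point `n` of the unit sphere. -/
def curvatureNumerator (c al s k W Q p x y z : ℝ) : ℝ :=
  (c - 2) * (al + 2 * y - (W - x ^ 2)) ^ 2
    + (al + 2 * y - (W - x ^ 2)) * (2 * s ^ 2 + 4 * k + 2 * W - 6 * x ^ 2)
    - 4 * s * (s * (W - x ^ 2) - 2 * z) - 2 * (Q - y ^ 2) - 4 * x * (p - x * y)
    - 2 * x ^ 2 * (W - x ^ 2)

/-- Latitude is the arcsine of the height and longitude the argument of the horizontal part, whose
modulus is cos φ; the poles are included. -/
theorem exists_normalPart_eq (n : Fin 3 → ℝ) (hn : n ⬝ᵥ n = 1) :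
    ∃ θ φ, ∀ a, normalPart a θ φ = a ⬝ᵥ n := by
  rw [dotProduct, Fin.sum_univ_three] at hn
  have h2 : n 2 ^ 2 ≤ 1 := by nlinarith [sq_nonneg (n 0), sq_nonneg (n 1)]
  have h2' := abs_le.1 (abs_le_one_iff_mul_self_le_one.2 (by nlinarith) : |n 2| ≤ 1)
  set z : ℂ := ⟨n 0, n 1⟩ with hz
  have hnorm : ‖z‖ = Real.cos (Real.arcsin (n 2)) := by
    rw [Real.cos_arcsin, Complex.norm_def, Complex.normSq_mk]
    congr 1
    linarith
  have h0 : Real.cos z.arg * Real.cos (Real.arcsin (n 2)) = n 0 := by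
    rw [← hnorm, mul_comm, Complex.norm_mul_cos_arg]
  have h1 : Real.sin z.arg * Real.cos (Real.arcsin (n 2)) = n 1 := by
    rw [← hnorm, mul_comm, Complex.norm_mul_sin_arg]
  refine ⟨z.arg, Real.arcsin (n 2), fun a => ?_⟩
  rw [normalPart, h0, h1, Real.sin_arcsin h2'.1 h2'.2, dotProduct, Fin.sum_univ_three]

theorem dotProduct_self_pos {n : Fin 3 → ℝ} (hn : n ≠ 0) : 0 < n ⬝ᵥ n :=
  lt_of_le_of_ne (Finset.sum_nonneg fun i _ => mul_self_nonneg (n i))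
    fun h => hn (dotProduct_self_eq_zero.1 h.symm)

theorem exists_orthogonal (w : Fin 3 → ℝ) : ∃ u : Fin 3 → ℝ, u ≠ 0 ∧ w ⬝ᵥ u = 0 := by
  by_cases h : w 0 = 0
  · refine ⟨![1, 0, 0], fun h' => by simpa using congrFun h' 0, ?_⟩
    simp [dotProduct, Fin.sum_univ_three, h]
  · refine ⟨![w 1, -w 0, 0], fun h' => h (by simpa using congrFun h' 1), ?_⟩
    simp [dotProduct, Fin.sum_univ_three]
    ring

section Numerator

variable {c al s k : ℝ} {q w : Fin 3 → ℝ}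

/-- The odd part of the numerator, made homogeneous. -/
theorem numerator_odd
    (H : ∀ n : Fin 3 → ℝ, n ⬝ᵥ n = 1 → curvatureNumerator c al s k (w ⬝ᵥ w) (q ⬝ᵥ q) (w ⬝ᵥ q)
      (w ⬝ᵥ n) (q ⬝ᵥ n) (q ⬝ᵥ crossProduct w n) = 0) (n : Fin 3 → ℝ) :
    (q ⬝ᵥ n) * ((4 * c - 16) * (w ⬝ᵥ n) ^ 2 + (4 * (c - 2) * (al - w ⬝ᵥ w)
        + 2 * (2 * s ^ 2 + 4 * k + 2 * (w ⬝ᵥ w))) * (n ⬝ᵥ n))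
      + (8 * s * (q ⬝ᵥ crossProduct w n) - 4 * (w ⬝ᵥ q) * (w ⬝ᵥ n)) * (n ⬝ᵥ n) = 0 := by
  rcases eq_or_ne n 0 with rfl | hn
  · simp
  have hN : 0 < n ⬝ᵥ n := dotProduct_self_pos hn
  obtain ⟨r, hr, hrN⟩ : ∃ r : ℝ, 0 < r ∧ r ^ 2 = n ⬝ᵥ n :=
    ⟨√(n ⬝ᵥ n), Real.sqrt_pos.2 hN, Real.sq_sqrt hN.le⟩
  have h1 := H (r⁻¹ • n) (by
    rw [smul_dotProduct, dotProduct_smul, ← hrN, smul_eq_mul, smul_eq_mul]; field_simp)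
  have h2 := H (-(r⁻¹ • n)) (by
    rw [neg_dotProduct_neg, smul_dotProduct, dotProduct_smul, ← hrN, smul_eq_mul, smul_eq_mul]
    field_simp)
  simp only [dotProduct_neg, map_neg, map_smul, dotProduct_smul, smul_eq_mul,
    curvatureNumerator] at h1 h2
  rw [← hrN]
  generalize w ⬝ᵥ n = x at *
  generalize q ⬝ᵥ n = y at *
  generalize q ⬝ᵥ crossProduct w n = z at *
  have h3 : x = r * (r⁻¹ * x) := by field_simp
  have h4 : y = r * (r⁻¹ * y) := by field_simp
  have h5 : z = r * (r⁻¹ * z) := by field_simp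
  generalize r⁻¹ * x = x' at *
  generalize r⁻¹ * y = y' at *
  generalize r⁻¹ * z = z' at *
  subst h3 h4 h5
  -- Antipodal points cancel the even terms; multiplying by r³ makes the odd part a cubic form in n.
  linear_combination r ^ 3 / 2 * (h1 - h2)

theorem numerator_even_of_drift_eq_zero
    (H : ∀ n : Fin 3 → ℝ, n ⬝ᵥ n = 1 → curvatureNumerator c al s k (w ⬝ᵥ w) 0 0
      (w ⬝ᵥ n) 0 0 = 0) (n : Fin 3 → ℝ) :
    (c - 6) * (w ⬝ᵥ n) ^ 4
      + (2 * (c - 5) * (al - w ⬝ᵥ w) + 6 * s ^ 2 + 4 * k) * (w ⬝ᵥ n) ^ 2 * (n ⬝ᵥ n)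
      + ((c - 2) * (al - w ⬝ᵥ w) ^ 2 + (al - w ⬝ᵥ w) * (2 * s ^ 2 + 4 * k + 2 * (w ⬝ᵥ w))
        - 4 * s ^ 2 * (w ⬝ᵥ w)) * (n ⬝ᵥ n) ^ 2 = 0 := by
  rcases eq_or_ne n 0 with rfl | hn
  · simp
  have hN : 0 < n ⬝ᵥ n := dotProduct_self_pos hn
  obtain ⟨r, hr, hrN⟩ : ∃ r : ℝ, 0 < r ∧ r ^ 2 = n ⬝ᵥ n :=
    ⟨√(n ⬝ᵥ n), Real.sqrt_pos.2 hN, Real.sq_sqrt hN.le⟩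
  have h1 := H (r⁻¹ • n) (by
    rw [smul_dotProduct, dotProduct_smul, ← hrN, smul_eq_mul, smul_eq_mul]; field_simp)
  simp only [dotProduct_smul, smul_eq_mul, curvatureNumerator] at h1
  rw [← hrN]
  generalize w ⬝ᵥ n = x at *
  have h3 : x = r * (r⁻¹ * x) := by field_simp
  generalize r⁻¹ * x = x' at *
  subst h3
  linear_combination r ^ 4 * h1

/-- The cubic form is tested on a few vectors. Its x²y coefficient 4c - 16 is nonzero, which
excludes first a component of q orthogonal to w, then one along w. -/
theorem drift_eq_zero_of_axis_ne_zero (hc : c ≠ 4) (hw : w ≠ 0)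
    (H : ∀ n : Fin 3 → ℝ, n ⬝ᵥ n = 1 → curvatureNumerator c al s k (w ⬝ᵥ w) (q ⬝ᵥ q) (w ⬝ᵥ q)
      (w ⬝ᵥ n) (q ⬝ᵥ n) (q ⬝ᵥ crossProduct w n) = 0) : q = 0 := by
  have T := numerator_odd H
  have hA : 4 * c - 16 ≠ 0 := fun h => hc (by linarith)
  have hW : w ⬝ᵥ w ≠ 0 := fun h => hw (dotProduct_self_eq_zero.1 h)
  set W := w ⬝ᵥ w with hWdef
  set p := w ⬝ᵥ q with hp
  generalize 4 * (c - 2) * (al - W) + 2 * (2 * s ^ 2 + 4 * k + 2 * W) = B at T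
  -- The component of q orthogonal to w, scaled by |w|². The triple product of q, w and v vanishes,
  -- so no z-term appears below.
  set v : Fin 3 → ℝ := W • q - p • w with hv
  have hqw : q ⬝ᵥ w = p := dotProduct_comm _ _
  have wv : w ⬝ᵥ v = 0 := by
    simp only [hv, dotProduct_sub, dotProduct_smul, smul_eq_mul, ← hWdef, ← hp]; ring
  have vw : v ⬝ᵥ w = 0 := by rw [dotProduct_comm, wv]
  have zw : q ⬝ᵥ crossProduct w w = 0 := by simp
  have zv : q ⬝ᵥ crossProduct w v = 0 := by simp [hv]
  have vv : v ⬝ᵥ v = W * (q ⬝ᵥ v) := by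
    nth_rw 1 [hv]
    rw [sub_dotProduct, smul_dotProduct, smul_dotProduct, wv]; simp
  have hqv : q ⬝ᵥ v = 0 := by
    by_contra hne
    have t1 := T v
    have t2 := T (v + w)
    have t3 := T (v - w)
    simp only [map_add, map_sub, dotProduct_add, dotProduct_sub, add_dotProduct, sub_dotProduct,
      wv, vw, zw, zv, vv, hqw, ← hWdef] at t1 t2 t3
    have hB : B = 0 := by
      have : (q ⬝ᵥ v) * (B * (W * (q ⬝ᵥ v))) = 0 := by linear_combination t1
      simpa [hne, hW] using this
    subst hB
    -- Averaging over v + w and v - w removes the terms odd in w, in particular those with p.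
    have : (4 * c - 16) * (W ^ 2 * (q ⬝ᵥ v)) = 0 := by linear_combination (t2 + t3) / 2
    simp [hA, hne, hW] at this
  have hv0 : v = 0 := dotProduct_self_eq_zero.1 (by rw [vv, hqv, mul_zero])
  have hq : W • q = p • w := sub_eq_zero.1 hv0
  -- Now q is parallel to w: the vector w + u, with u orthogonal to w, determines B = 4W, and then w
  -- itself contradicts c ≠ 4.
  have hp0 : p = 0 := by
    by_contra hne
    obtain ⟨u, hu, wu⟩ := exists_orthogonal w
    have hU : u ⬝ᵥ u ≠ 0 := fun h => hu (dotProduct_self_eq_zero.1 h)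
    have uw : u ⬝ᵥ w = 0 := by rw [dotProduct_comm, wu]
    have qu : q ⬝ᵥ u = 0 := by
      have := congrArg (· ⬝ᵥ u) hq
      simpa [smul_dotProduct, wu, hW] using this
    have zu : q ⬝ᵥ crossProduct w u = 0 := by
      have := congrArg (· ⬝ᵥ crossProduct w u) hq
      simpa [smul_dotProduct, hW] using this
    have t1 := T w
    have t2 := T (w + u)
    simp only [map_add, dotProduct_add, add_dotProduct, wu, uw, qu, zu, zw, hqw,
      ← hWdef] at t1 t2
    have h1 : p * ((B - 4 * W) * (u ⬝ᵥ u)) = 0 := by linear_combination t2 - t1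
    have h2 : B = 4 * W := by
      have : B - 4 * W = 0 := by simpa [hne, hU] using h1
      linarith
    subst h2
    have : p * ((4 * c - 16) * W ^ 2) = 0 := by linear_combination t1
    simp [hne, hA, hW] at this
  rw [hp0, zero_smul] at hq
  simpa [hW] using hq

theorem numerator_not_identically_zero {β : ℝ} (hc : c = 6 ∨ c = -6)
    (hal : al = s ^ 2 + k + β) (hβ : 0 ≤ β) (hk : 0 ≤ k)
    (hkw : (w ⬝ᵥ w) * (w ⬝ᵥ w) ≤ (w ⬝ᵥ w) * k)
    (hne : ∃ n : Fin 3 → ℝ, al + 2 * (q ⬝ᵥ n) - (w ⬝ᵥ w - (w ⬝ᵥ n) ^ 2) ≠ 0)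
    (H : ∀ n : Fin 3 → ℝ, n ⬝ᵥ n = 1 → curvatureNumerator c al s k (w ⬝ᵥ w) (q ⬝ᵥ q) (w ⬝ᵥ q)
      (w ⬝ᵥ n) (q ⬝ᵥ n) (q ⬝ᵥ crossProduct w n) = 0) : False := by
  rcases eq_or_ne w 0 with rfl | hw
  · simp only [zero_dotProduct, map_zero, LinearMap.zero_apply, dotProduct_zero,
      curvatureNumerator] at H hne
    have hE : ∀ n : Fin 3 → ℝ, n ⬝ᵥ n = 1 → (c - 2) * al ^ 2 + al * (2 * s ^ 2 + 4 * k)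
        - 2 * (q ⬝ᵥ q) + (4 * c - 6) * (q ⬝ᵥ n) ^ 2 = 0 := by
      intro n hn
      have h1 := H n hn
      have h2 := H (-n) (by rw [neg_dotProduct_neg, hn])
      rw [dotProduct_neg] at h2
      linear_combination (h1 + h2) / 2
    have hq : q = 0 := by
      by_contra hq
      have hQ := dotProduct_self_pos hq
      obtain ⟨r, hr, hrQ⟩ : ∃ r : ℝ, 0 < r ∧ r ^ 2 = q ⬝ᵥ q :=
        ⟨√(q ⬝ᵥ q), Real.sqrt_pos.2 hQ, Real.sq_sqrt hQ.le⟩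
      have h1 := hE (r⁻¹ • q) (by
        rw [smul_dotProduct, dotProduct_smul, ← hrQ, smul_eq_mul, smul_eq_mul]; field_simp)
      have h2 : q ⬝ᵥ (r⁻¹ • q) = r := by
        rw [dotProduct_smul, ← hrQ, smul_eq_mul]; field_simp
      rw [h2, hrQ] at h1
      have h3 : ∀ i, (c - 2) * al ^ 2 + al * (2 * s ^ 2 + 4 * k)
          - 2 * (q ⬝ᵥ q) + (4 * c - 6) * q i ^ 2 = 0 := by
        intro i
        simpa using hE (Pi.single i 1) (by simp)
      have h4 : q ⬝ᵥ q = q 0 ^ 2 + q 1 ^ 2 + q 2 ^ 2 := by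
        simp [dotProduct, Fin.sum_univ_three]; ring
      -- The even part forces (q·n)² to be constant on the sphere, since 4c - 6 ≠ 0. It is |q|² at
      -- q/|q|, while over the coordinate basis it only sums to |q|².
      have h5 : (4 * c - 6) * (q ⬝ᵥ q) = 0 := by
        linear_combination (3 / 2) * h1 - (h3 0 + h3 1 + h3 2) / 2 - (2 * c - 3) * h4
      rcases hc with rfl | rfl <;> norm_num [hQ.ne'] at h5
    subst hq
    have h1 := H ![1, 0, 0] (by simp [dotProduct, Fin.sum_univ_three])
    simp only [zero_dotProduct] at h1 hne
    obtain ⟨-, hne⟩ := hne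
    have hal0 : al ≠ 0 := fun h => hne (by rw [h]; ring)
    have h2 : (c - 2) * al + 2 * s ^ 2 + 4 * k = 0 := by
      have : al * ((c - 2) * al + 2 * s ^ 2 + 4 * k) = 0 := by linear_combination h1
      simpa [hal0] using this
    apply hal0
    -- With al = s² + k + β, the relation `h2` is a vanishing sum of nonnegative terms: 4al + 2s² +
    -- 4k for c = 6, and 6s² + 4k + 8β up to sign for c = -6. Either way al = 0.
    rcases hc with rfl | rfl
    · nlinarith [sq_nonneg s]
    · nlinarith [sq_nonneg s]
  · obtain rfl : q = 0 := drift_eq_zero_of_axis_ne_zero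
      (by rcases hc with rfl | rfl <;> norm_num) hw H
    simp only [zero_dotProduct, dotProduct_zero] at H
    have E := numerator_even_of_drift_eq_zero H
    have hW : 0 < w ⬝ᵥ w := dotProduct_self_pos hw
    obtain ⟨u, hu, wu⟩ := exists_orthogonal w
    have hU : u ⬝ᵥ u ≠ 0 := fun h => hu (dotProduct_self_eq_zero.1 h)
    have uw : u ⬝ᵥ w = 0 := by rw [dotProduct_comm, wu]
    -- With u orthogonal to w, the vectors u, w and w + u isolate the three coefficients of the
    -- quartic form.
    have e1 := E u
    have e2 := E w
    have e3 := E (w + u)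
    simp only [dotProduct_add, add_dotProduct, wu, uw] at e1 e2 e3
    set W := w ⬝ᵥ w
    set U := u ⬝ᵥ u
    have hb0 : (c - 2) * (al - W) ^ 2 + (al - W) * (2 * s ^ 2 + 4 * k + 2 * W)
        - 4 * s ^ 2 * W = 0 := by
      have : ((c - 2) * (al - W) ^ 2 + (al - W) * (2 * s ^ 2 + 4 * k + 2 * W)
        - 4 * s ^ 2 * W) * U ^ 2 = 0 := by linear_combination e1
      simpa [hU] using this
    have hb1 : 2 * (c - 5) * (al - W) + 6 * s ^ 2 + 4 * k = 0 := by
      have : (2 * (c - 5) * (al - W) + 6 * s ^ 2 + 4 * k) * (W ^ 2 * U) = 0 := by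
        linear_combination e3 - e2 - ((W + U) ^ 2 - W ^ 2) * hb0
      simpa [hU, hW.ne'] using this
    have hkW : W ≤ k := le_of_mul_le_mul_left hkw hW
    have hc6 : c = 6 := by
      have : (c - 6) * W ^ 4 = 0 := by
        linear_combination e2 - W ^ 3 * hb1 - W ^ 2 * hb0
      have : c - 6 = 0 := by simpa [hW.ne'] using this
      linarith
    subst hc6
    -- For c = 6, `hb1` reads 2(al - W) + 6s² + 4k = 0, impossible since al ≥ k ≥ W > 0.
    nlinarith [sq_nonneg s]

end Numerator

/-! ### From an open set of parameters to the whole sphere, and conclusion -/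

theorem numerator_eq_zero_of_isOpen {c al s k : ℝ} {q w : Fin 3 → ℝ} {O : Set (ℝ × ℝ)}
    (hO : IsOpen O) (hne : O.Nonempty)
    (h : ∀ p ∈ O, curvatureNumerator c al s k (w ⬝ᵥ w) (q ⬝ᵥ q) (w ⬝ᵥ q)
      (normalPart w p.1 p.2) (normalPart q p.1 p.2)
      (northPart w p.1 p.2 * eastPart q p.1 - eastPart w p.1 * northPart q p.1 p.2) = 0)
    (n : Fin 3 → ℝ) (hn : n ⬝ᵥ n = 1) :
    curvatureNumerator c al s k (w ⬝ᵥ w) (q ⬝ᵥ q) (w ⬝ᵥ q)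
      (w ⬝ᵥ n) (q ⬝ᵥ n) (q ⬝ᵥ crossProduct w n) = 0 := by
  -- The tangential determinant of q and w is the normal component of q × w, which makes it linear
  -- in n.
  have hz : ∀ θ φ, northPart w θ φ * eastPart q θ - eastPart w θ * northPart q θ φ =
      normalPart (crossProduct q w) θ φ := by
    intro θ φ
    rw [cross_apply]
    simp only [northPart, eastPart, normalPart, Matrix.cons_val]
    linear_combination (q 0 * w 1 - q 1 * w 0) * Real.sin φ * Real.sin_sq_add_cos_sq θ
  simp only [hz] at h
  have hF : AnalyticOnNhd ℝ (fun p : ℝ × ℝ => curvatureNumerator c al s k (w ⬝ᵥ w) (q ⬝ᵥ q)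
      (w ⬝ᵥ q) (normalPart w p.1 p.2) (normalPart q p.1 p.2)
      (normalPart (crossProduct q w) p.1 p.2)) Set.univ := by
    rw [← contDiff_omega_iff_analyticOnNhd]
    unfold curvatureNumerator normalPart
    fun_prop
  obtain ⟨p₀, hp₀⟩ := hne
  have h0 := hF.eqOn_of_preconnected_of_eventuallyEq (g := fun _ => 0) analyticOnNhd_const
    isPreconnected_univ (Set.mem_univ p₀)
    (by filter_upwards [hO.mem_nhds hp₀] with p hp using h p hp)
  obtain ⟨θ, φ, hθφ⟩ := exists_normalPart_eq n hn
  have h1 := h0 (Set.mem_univ (θ, φ))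
  simp only [hθφ] at h1
  have h2 : crossProduct q w ⬝ᵥ n = q ⬝ᵥ crossProduct w n := by
    simp [cross_apply, dotProduct, Fin.sum_univ_three]
    ring
  rwa [h2] at h1

/-- The frame is orthonormal; this converts tangential products into |w|², |q|², w·q and normal
components. -/
theorem eastPart_northPart_dot (a b : Fin 3 → ℝ) (θ φ : ℝ) :
    eastPart a θ * eastPart b θ + northPart a θ φ * northPart b θ φ =
      a ⬝ᵥ b - normalPart a θ φ * normalPart b θ φ := by
  simp only [eastPart, northPart, normalPart, dotProduct, Fin.sum_univ_three]
  have hθ := Real.sin_sq_add_cos_sq θ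
  have hφ := Real.sin_sq_add_cos_sq φ
  linear_combination (a 0 * b 0 + a 1 * b 1) * hθ + (a 0 * b 0 * Real.cos θ ^ 2
    + a 1 * b 1 * Real.sin θ ^ 2 + a 2 * b 2
    + (a 0 * b 1 + a 1 * b 0) * (Real.sin θ * Real.cos θ)) * hφ

theorem EquiformMotion.scalarCurvature_ne (M : EquiformMotion) (h : M.FoliatedBySpheres)
    (h' : M.NoTranslation) {O : Set (ℝ × ℝ)} (hO : IsOpen O) (hne : O.Nonempty)
    (hreg : ∀ p ∈ O, RegularAt M.surface ![0, p.1, p.2]) {c : ℝ} (hc : c = 6 ∨ c = -6) :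
    ¬ ∀ p ∈ O, scalarCurvature M.surface ![0, p.1, p.2] = c := by
  intro hK
  have hmet := M.firstForm_surface h h'
  have hdet : ∀ p ∈ O, (firstForm M.surface ![0, p.1, p.2]).det ≠ 0 := fun p hp =>
    det_firstForm_ne_zero (hreg p hp)
  have hβ : 0 ≤ M.bPrime ⬝ᵥ M.bPrime :=
    Finset.sum_nonneg fun i _ => mul_self_nonneg (M.bPrime i)
  have hk : 0 ≤ M.stretch := Finset.sum_nonneg fun i _ => sq_nonneg (M.Omega i 0)
  refine numerator_not_identically_zero hc rfl hβ hk (M.sq_axis_le h) ?_ (numerator_eq_zero_of_isOpen (s := M.sPrime) (q := M.drift) hO hne ?_)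
  · obtain ⟨p, hp⟩ := hne
    refine ⟨![Real.cos p.1 * Real.cos p.2, Real.sin p.1 * Real.cos p.2, Real.sin p.2], ?_⟩
    have h1 : ∀ a : Fin 3 → ℝ, a ⬝ᵥ ![Real.cos p.1 * Real.cos p.2,
        Real.sin p.1 * Real.cos p.2, Real.sin p.2] = normalPart a p.1 p.2 := by
      intro a; simp [dotProduct, Fin.sum_univ_three, normalPart]
    have h2 := hdet p hp
    rw [hmet, det_metric] at h2
    have h3 := left_ne_zero_of_mul h2
    rw [gramFactor] at h3
    rw [h1, h1]
    intro h4
    apply h3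
    linear_combination h4 - eastPart_northPart_dot M.axis M.axis p.1 p.2
  · intro p hp
    have h1 := scalarCurvature_of_firstForm_eq _ _ _ _ _ p.1 p.2 hmet (hdet p hp)
    rw [hK p hp] at h1
    have ww := eastPart_northPart_dot M.axis M.axis p.1 p.2
    have qq := eastPart_northPart_dot M.drift M.drift p.1 p.2
    have wq := eastPart_northPart_dot M.axis M.drift p.1 p.2
    have hW : M.axis ⬝ᵥ M.axis = eastPart M.axis p.1 ^ 2 + northPart M.axis p.1 p.2 ^ 2 +
        normalPart M.axis p.1 p.2 ^ 2 := by linear_combination -ww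
    have hQ : M.drift ⬝ᵥ M.drift = eastPart M.drift p.1 ^ 2 + northPart M.drift p.1 p.2 ^ 2 +
        normalPart M.drift p.1 p.2 ^ 2 := by linear_combination -qq
    have hP : M.axis ⬝ᵥ M.drift = eastPart M.axis p.1 * eastPart M.drift p.1 +
        northPart M.axis p.1 p.2 * northPart M.drift p.1 p.2 +
        normalPart M.axis p.1 p.2 * normalPart M.drift p.1 p.2 := by linear_combination -wq
    rw [curvatureNumerator, hW, hQ, hP]
    rw [gramFactor] at h1
    linear_combination h1

end Kinematic

theorem mainTheorem5 (M : Kinematic.EquiformMotion)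
    (hsph : M.FoliatedBySpheres) (htr : M.NoTranslation)
    (W : Set (ℝ × ℝ)) (hWo : IsOpen W) (hWne : W.Nonempty)
    (hreg : ∀ p ∈ W, Kinematic.RegularAt M.surface ![0, p.1, p.2]) :
    (¬ ∀ p ∈ W, Kinematic.scalarCurvature M.surface ![0, p.1, p.2] = -6) ∧
    (¬ ∀ p ∈ W, -Kinematic.scalarCurvature M.surface ![0, p.1, p.2] = -6) := by
  have key : ∀ c : ℝ, c = 6 ∨ c = -6 →
      ¬ ∀ p ∈ W, Kinematic.scalarCurvature M.surface ![0, p.1, p.2] = c :=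
    fun c hc => M.scalarCurvature_ne hsph htr hWo hWne hreg hc
  exact ⟨key (-6) (Or.inr rfl), fun h => key 6 (Or.inl rfl) fun p hp => by linarith [h p hp]⟩
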